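/- Let $G$ be a (finite-dimensional, real, smooth) local Lie group with unit $e$ and Lie algebra $\mathfrak g$, let $H$ be a local closed Lie subgroup with Lie algebra $\mathfrak h$, and let $Q\ni e$ be, near $e$, a smooth section of the left cosets $G/H$, i.e. a submanifold through $e$ whose tangent space $V=T_eQ\subset\mathfrak g$ satisfies $\mathfrak g=V\oplus\mathfrak h$. Let $\Pi:\mathfrak g\to V$ be the projection along $\mathfrak h$. There is a map $\varphi:V\to\mathfrak h$, continuous at $0$ with $\varphi(0)=0$, such that $\exp(\xi+\varphi(\xi))\in Q$ for all $\xi\in V$ near $0$. Any such $\varphi$ is smooth at $0$ with $d\varphi(0)=0$; let $R=\tfrac12 D^2\varphi(0)$ be its quadratic part, a symmetric bilinear map $V\times V\to\mathfrak h$, so that $\varphi(\xi)=R(\xi,\xi)+O(|\xi|^3)$. Use $\bar x\in V$ as (normal) coordinate of the point $x=\exp(\bar x+\varphi(\bar x))$ of $Q$. Let $\times$ be the local loop operation on $Q$ in which $x\times y$ is the point of $Q$ near $e$ with $x\cdot y\in(x\times y)H$, and let $\mu:V\times V\to V$, $\mu(\bar x,\bar y)=\overline{x\times y}$, be its expression in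 normal coordinates; it is smooth near $(0,0)$. Consider on $V\times V$ near $(0,0)$ the 3-web with leaves $x=\mathrm{const}$, $y=\mathrm{const}$, $\mu(x,y)=\mathrm{const}$, the forms $\omega_1^i=\frac{\partial\mu^i}{\partial x^\alpha}dx^\alpha$, $\omega_2^i=\frac{\partial\mu^i}{\partial y^\beta}dy^\beta$, and the Chern connection $\omega^k_j=\Gamma^k_{ij}\omega_1^i+\Gamma^k_{jl}\omega_2^l$, where $\Gamma^k_{ij}=-\tilde P^\alpha_i\tilde Q^\beta_j\frac{\partial^2\mu^k}{\partial x^\alpha\partial y^\beta}$ and $\tilde P,\tilde Q$ are the inverses of the matrices $\left(\frac{\partial\mu^i}{\partial x^\alpha}\right)$, $\left(\frac{\partial\mu^i}{\partial y^\beta}\right)$. The torsion tensor $a^k_{ij}=-a^k_{ji}$ and the curvature tensor $b^k_{jlm}$ of the web are defined by the structure equations $$d\omega_1^k=\omega_1^l\wedge\omega^k_l+a^k_{ij}\,\omega_1^i\wedge\omega_1^j,\qquad d\omega_2^k=\omega_2^l\wedge\omega^k_l-a^k_{ij}\,\omega_2^i\wedge\omega_2^j,\qquad d\omega^k_j=\omega^i_j\wedge\omega^k_i+b^k_{jlm}\,\omega_1^l\wedge\omega_2^m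 .$$ Write $a(x,y)^k=a^k_{ij}x^iy^j$ and $b(x,y,z)^k=b^k_{jlm}x^jy^lz^m$ for their values at the point $(e,e)$, i.e. at $(0,0)$ in the coordinates. Then these values exist, are unique, and for all $x,y,z\in V$ $$a(x,y)=-\tfrac12\,\Pi[x,y],$$ $$b(x,y,z)=-\tfrac12\,\Pi[[x,y],z]+\tfrac12\,\Pi[\Pi[x,y],z]-2\,\Pi[R(x,y),z].$$ -/

import Mathlib

open Set Filter Topology
open scoped ContDiff

noncomputable section

/-- A (smooth) local Lie group, written in a chart of the model space `E` centred at the unit, so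
that the unit is `0`. The chart is arbitrary: it is not assumed to be a normal chart.
Products are meaningful on `U × U`, inverses on `U₀ ⊆ U`. -/
structure LocalLieGroup (E : Type*) [NormedAddCommGroup E] [NormedSpace ℝ E] where
  U : Set E
  U₀ : Set E
  isOpen_U : IsOpen U
  isOpen_U₀ : IsOpen U₀
  zero_mem_U₀ : (0 : E) ∈ U₀
  U₀_subset : U₀ ⊆ U
  mul : E → E → E
  inv : E → E
  contDiffOn_mul : ContDiffOn ℝ ∞ (fun p : E × E => mul p.1 p.2) (U ×ˢ U)
  contDiffOn_inv : ContDiffOn ℝ ∞ inv U₀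
  inv_mem : ∀ x ∈ U₀, inv x ∈ U
  zero_mul : ∀ x ∈ U, mul 0 x = x
  mul_zero : ∀ x ∈ U, mul x 0 = x
  inv_mul : ∀ x ∈ U₀, mul (inv x) x = 0
  mul_inv : ∀ x ∈ U₀, mul x (inv x) = 0
  mul_assoc : ∀ x ∈ U, ∀ y ∈ U, ∀ z ∈ U, mul x y ∈ U → mul y z ∈ U →
    mul (mul x y) z = mul x (mul y z)

/-- Near `0`, the set `S` is a smooth embedded submanifold passing through `0` with tangent
space `T` at `0`: some chart `Φ`, normalised to have the identity as its derivative
at `0`, maps `S` onto the linear subspace `T`. -/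
def IsSubmanifoldAtZero {E : Type*} [NormedAddCommGroup E] [NormedSpace ℝ E]
    (S : Set E) (T : Submodule ℝ E) : Prop :=
  ∃ Φ : OpenPartialHomeomorph E E, (0 : E) ∈ Φ.source ∧ Φ 0 = 0 ∧
    ContDiffOn ℝ ∞ Φ Φ.source ∧ ContDiffOn ℝ ∞ Φ.symm Φ.target ∧
    HasFDerivAt Φ (ContinuousLinearMap.id ℝ E) 0 ∧
    ∀ x ∈ Φ.source, x ∈ S ↔ Φ x ∈ T

namespace LocalLieGroup

variable {E : Type*} [NormedAddCommGroup E] [NormedSpace ℝ E]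

/-- The left-invariant vector field `g ↦ d(L_g)₀ ξ` with value `ξ` at the unit. -/
def leftInvariantField (G : LocalLieGroup E) (ξ : E) : E → E :=
  fun g => fderiv ℝ (fun y => G.mul g y) 0 ξ

/-- The bracket of the Lie algebra `T₀ G = E`: the value at the unit of the Lie bracket of
left-invariant vector fields. -/
def bracket (G : LocalLieGroup E) (ξ η : E) : E :=
  VectorField.lieBracket ℝ (G.leftInvariantField ξ) (G.leftInvariantField η) 0

/-- `g` is the endpoint at time `1` of the integral curve, issued from the unit, of the
left-invariant vector field of `ξ`. -/
def IsExp (G : LocalLieGroup E) (ξ g : E) : Prop :=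
  ∃ γ : ℝ → E, γ 0 = 0 ∧ γ 1 = g ∧ ∀ t ∈ Icc (0 : ℝ) 1, γ t ∈ G.U ∧
    HasDerivWithinAt γ (G.leftInvariantField ξ (γ t)) (Icc 0 1) t

open Classical in
/-- The exponential map (with value `0` where the integral curve does not live up to time `1`;
this does not happen for `ξ` near `0`). -/
def exp (G : LocalLieGroup E) (ξ : E) : E :=
  if h : ∃ g, G.IsExp ξ g then h.choose else 0

/-- `H` is a (locally closed) local Lie subgroup of `G` with Lie algebra `𝔥`. -/
structure IsLocalLieSubgroup (G : LocalLieGroup E) (H : Set E) (𝔥 : Submodule ℝ E) : Prop where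
  subset_U : H ⊆ G.U
  isSubmanifold : IsSubmanifoldAtZero H 𝔥
  mul_mem : ∃ W ∈ 𝓝 (0 : E), ∀ x ∈ H ∩ W, ∀ y ∈ H ∩ W, G.mul x y ∈ H
  inv_mem : ∃ W ∈ 𝓝 (0 : E), ∀ x ∈ H ∩ W, G.inv x ∈ H

/-- `Q` is, near the unit, a smooth section of the left cosets of the local subgroup with Lie
algebra `𝔥`, with tangent space `V` at the unit: a submanifold through the unit,
transversal to the cosets and of complementary dimension. -/
structure IsLocalSection (Q : Set E) (V 𝔥 : Submodule ℝ E) : Prop where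
  isSubmanifold : IsSubmanifoldAtZero Q V
  isCompl : IsCompl V 𝔥

/-- The point of `G` with normal coordinate `x ∈ V`, namely `exp (x + φ x)`. -/
def point (G : LocalLieGroup E) {V 𝔥 : Submodule ℝ E} (φ : V → 𝔥) (x : V) : E :=
  G.exp ((x : E) + (φ x : E))

/-- `φ : V → 𝔥` is the map (a germ at `0`) defined by `exp (ξ + φ ξ) ∈ Q`. -/
structure IsSectionMap (G : LocalLieGroup E) (Q : Set E) {V 𝔥 : Submodule ℝ E}
    (φ : V → 𝔥) : Prop where
  map_zero : φ 0 = 0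
  continuousAt : ContinuousAt φ 0
  mem : ∀ᶠ ξ in 𝓝 (0 : V), G.point φ ξ ∈ Q

/-- `q` is a projection of `g` on `Q` parallel to `H`: `q ∈ Q` and `g ∈ q H`. -/
def IsProjection (G : LocalLieGroup E) (H Q : Set E) (g q : E) : Prop :=
  q ∈ Q ∧ ∃ h ∈ H, g = G.mul q h

/-- `μ` is (a germ at `(0, 0)` of) the composition law `x × y = Π_Q (x · y)` of the local loop `Q`,
written in the normal coordinates of `Q`. -/
structure IsLoopLaw (G : LocalLieGroup E) (H Q : Set E) {V 𝔥 : Submodule ℝ E} (φ : V → 𝔥)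
    (μ : V × V → V) : Prop where
  map_zero : μ 0 = 0
  continuousAt : ContinuousAt μ 0
  isProjection : ∀ᶠ p in 𝓝 (0 : V × V),
    G.IsProjection H Q (G.mul (G.point φ p.1) (G.point φ p.2)) (G.point φ (μ p))

end LocalLieGroup

/-- The quadratic part `R` of a map `φ` at `0`: the symmetric bilinear map `D²φ(0) / 2`, so that
`φ ξ = φ 0 + Dφ(0) ξ + R (ξ, ξ) + …`. -/
def quadraticPart {V W : Type*} [NormedAddCommGroup V] [NormedSpace ℝ V]
    [NormedAddCommGroup W] [NormedSpace ℝ W] (φ : V → W) (x y : V) : W :=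
  (1 / 2 : ℝ) • fderiv ℝ (fderiv ℝ φ) 0 x y

/-! The 3-web on `V × V` whose leaves are `x = const`, `y = const` and `μ (x, y) = const`, with its
Chern connection. Forms with one upper index are written as `V`-valued forms. -/

namespace ThreeWeb

variable {V : Type*} [NormedAddCommGroup V] [NormedSpace ℝ V]

/-- `P = ∂μ/∂x`. -/
def P (μ : V × V → V) (p : V × V) : V →L[ℝ] V := fderiv ℝ (fun x => μ (x, p.2)) p.1

/-- `Q = ∂μ/∂y`. -/
def Q (μ : V × V → V) (p : V × V) : V →L[ℝ] V := fderiv ℝ (fun y => μ (p.1, y)) p.2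

/-- `∂²μ/∂x∂y`, applied first to the `x`-direction and then to the `y`-direction. -/
def mixed (μ : V × V → V) (p : V × V) : V →L[ℝ] V →L[ℝ] V :=
  fderiv ℝ (fun x => Q μ (x, p.2)) p.1

/-- `ω₁ = P dx`. -/
def ω₁ (μ : V × V → V) (p : V × V) : V × V →L[ℝ] V := (P μ p).comp (.fst ℝ V V)

/-- `ω₂ = Q dy`. -/
def ω₂ (μ : V × V → V) (p : V × V) : V × V →L[ℝ] V := (Q μ p).comp (.snd ℝ V V)

/-- `Γ(u, v) = - ∂²μ/∂x∂y (P⁻¹ u, Q⁻¹ v)`. -/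
def Γ (μ : V × V → V) (p : V × V) : V →L[ℝ] V →L[ℝ] V :=
  -(mixed μ p).bilinearComp (P μ p).inverse (Q μ p).inverse

/-- The form `ω_v = Γ(ω₁, v) + Γ(v, ω₂)` of the Chern connection; for `v` the `j`-th basis
vector its components are the `ω^k_j = Γ^k_{ij} ω₁^i + Γ^k_{jl} ω₂^l`. -/
def connectionForm (μ : V × V → V) (v : V) (p : V × V) : V × V →L[ℝ] V :=
  ((Γ μ p).flip v).comp (ω₁ μ p) + (Γ μ p v).comp (ω₂ μ p)

/-- Exterior derivative of a `V`-valued 1-form, evaluated on two vectors: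
`dα(u, w) = (D_u α)(w) - (D_w α)(u)`. -/
def d (α : V × V → (V × V →L[ℝ] V)) (p u w : V × V) : V :=
  extDeriv (fun q => ContinuousAlternatingMap.ofSubsingleton ℝ (V × V) V (0 : Fin 1) (α q)) p
    ![u, w]

/-- `a` and `b` are the values at `p` of the torsion tensor and of the curvature tensor of the
3-web: `a` is skew-symmetric and the structure equations
`dω₁^k = ω₁^l ∧ ω^k_l + a^k_{ij} ω₁^i ∧ ω₁^j`,
`dω₂^k = ω₂^l ∧ ω^k_l - a^k_{ij} ω₂^i ∧ ω₂^j`,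
`dω^k_j = ω^i_j ∧ ω^k_i + b^k_{jlm} ω₁^l ∧ ω₂^m`
hold at `p`, where `(α ∧ β)(u, w) = α(u) β(w) - α(w) β(u)`,
`a(x, y)^k = a^k_{ij} x^i y^j` and `b(x, y, z)^k = b^k_{jlm} x^j y^l z^m`. -/
structure HasTensorsAt (μ : V × V → V) (p : V × V) (a : V →ₗ[ℝ] V →ₗ[ℝ] V)
    (b : V →ₗ[ℝ] V →ₗ[ℝ] V →ₗ[ℝ] V) : Prop where
  skew : ∀ x y, a x y = -a y x
  d_ω₁ : ∀ u w, d (ω₁ μ) p u w =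
    (connectionForm μ (ω₁ μ p u) p w - connectionForm μ (ω₁ μ p w) p u) +
      (a (ω₁ μ p u) (ω₁ μ p w) - a (ω₁ μ p w) (ω₁ μ p u))
  d_ω₂ : ∀ u w, d (ω₂ μ) p u w =
    (connectionForm μ (ω₂ μ p u) p w - connectionForm μ (ω₂ μ p w) p u) -
      (a (ω₂ μ p u) (ω₂ μ p w) - a (ω₂ μ p w) (ω₂ μ p u))
  d_connectionForm : ∀ v u w, d (connectionForm μ v) p u w =
    (connectionForm μ (connectionForm μ v p u) p w -
      connectionForm μ (connectionForm μ v p w) p u) +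
      (b v (ω₁ μ p u) (ω₂ μ p w) - b v (ω₁ μ p w) (ω₂ μ p u))

end ThreeWeb

end

/-! The theorem is a comparison of Taylor coefficients of order at most three at the unit. For a
smooth germ `F` on pairs with unit `0`, all pure derivatives beyond the first vanish, so its 3-jet
is carried by the mixed derivatives A = `mixedXY`, C = `mixedXXY`, D = `mixedXYY`.

For the group law `bch` in logarithmic coordinates, associativity together with m(x, x) = 2x
determines C and D from A: this is the Baker–Campbell–Hausdorff formula to third order, with A
antisymmetric, the Jacobi identity for A, and [x, y] = 2 A(x, y) (`mixedXXY_eq`, `mixedXYY_eq`,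
`jacobi`, `bracket_eq_bch`).

The loop law satisfies m(s x, s y) = m(s μ(x, y), k(x, y)) with s = id + φ and k valued in 𝔥. At
order two the V-component gives A of μ as ΠA, and the 𝔥-component gives the second coefficient of k
along (x, y) as (1 - Π)A(x, y) - 2R(x, y). At order three the V-component involves k only through
that coefficient, which yields C and D of μ (`loopLaw_cubic`, `loopLaw_mixed`).

On the web side P and Q are the identity at (0, 0), and the structure equations there amount to a(x,
y) = (A(y, x) - A(x, y))/2 and b(x, y, z) = the trilinear part of y(xz) - (yx)z
(`hasTensorsAt_iff`). Substituting the jets of μ and using Jacobi gives the formulas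
(`loopLaw_curvature`).

The analytic input is that exp is a smooth germ, that H is exp 𝔥 near the unit, and that the germs
of φ and μ exist, are unique and smooth; each rests on the inverse function theorem. -/

noncomputable section

/-! ### Taylor expansion to second and third order -/

section Taylor

open Asymptotics

variable {X Y : Type*} [NormedAddCommGroup X] [NormedSpace ℝ X]
  [NormedAddCommGroup Y] [NormedSpace ℝ Y]

theorem ContDiffAt.fderiv_infty {F : X → Y} {x : X} (hF : ContDiffAt ℝ ∞ F x) :
    ContDiffAt ℝ ∞ (fderiv ℝ F) x :=
  hF.fderiv_right (by simp)

theorem ContDiffAt.differentiableAt_infty {F : X → Y} {x : X} (hF : ContDiffAt ℝ ∞ F x) :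
    DifferentiableAt ℝ F x :=
  hF.differentiableAt (by simp)

theorem ContDiffAt.eventually_differentiableAt {F : X → Y} {x : X} (hF : ContDiffAt ℝ ∞ F x) :
    ∀ᶠ y in 𝓝 x, DifferentiableAt ℝ F y := by
  have h1 : ContDiffAt ℝ 1 F x := hF.of_le (by exact_mod_cast le_top)
  filter_upwards [h1.eventually (by simp)] with y hy using hy.differentiableAt (by simp)

theorem ContDiffAt.fderiv_fderiv_symm {F : X → Y} {x : X} (hF : ContDiffAt ℝ ∞ F x) (u v : X) :
    fderiv ℝ (fderiv ℝ F) x u v = fderiv ℝ (fderiv ℝ F) x v u :=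
  (hF.isSymmSndFDerivAt (by simpa using ENat.LEInfty.out)).eq u v

theorem ContDiffAt.fderiv_fderiv_fderiv_symm_left {F : X → Y} {x : X} (hF : ContDiffAt ℝ ∞ F x)
    (u v w : X) : fderiv ℝ (fderiv ℝ (fderiv ℝ F)) x u v w =
      fderiv ℝ (fderiv ℝ (fderiv ℝ F)) x v u w := by
  rw [hF.fderiv_infty.fderiv_fderiv_symm]

/-- The second derivative is symmetric at every nearby point, and this identity may be
differentiated. -/
theorem ContDiffAt.fderiv_fderiv_fderiv_symm_right {F : X → Y} {x : X} (hF : ContDiffAt ℝ ∞ F x)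
    (u v w : X) : fderiv ℝ (fderiv ℝ (fderiv ℝ F)) x u v w =
      fderiv ℝ (fderiv ℝ (fderiv ℝ F)) x u w v := by
  have hd : DifferentiableAt ℝ (fderiv ℝ (fderiv ℝ F)) x :=
    hF.fderiv_infty.fderiv_infty.differentiableAt_infty
  have h (v w : X) : fderiv ℝ (fun y => fderiv ℝ (fderiv ℝ F) y v w) x u =
      fderiv ℝ (fderiv ℝ (fderiv ℝ F)) x u v w := by
    have h1 := (hd.hasFDerivAt.clm_apply (hasFDerivAt_const v x)).clm_apply (hasFDerivAt_const w x)
    rw [h1.fderiv]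
    simp
  rw [← h v w, ← h w v]
  congr 1
  apply Filter.EventuallyEq.fderiv_eq
  have h2 : ContDiffAt ℝ 2 F x := hF.of_le ENat.LEInfty.out
  filter_upwards [h2.eventually (by simp)] with y hy
  exact (hy.isSymmSndFDerivAt (by simp)).eq v w

/-- Mean value inequality on the closed ball of radius ‖x‖. Each use raises the order of a Taylor
estimate by one, passing from the derivative to the function. -/
theorem isLittleO_pow_succ_of_fderiv {g : X → Y} {n : ℕ} (h0 : g 0 = 0)
    (hd : ∀ᶠ x in 𝓝 (0 : X), DifferentiableAt ℝ g x)
    (ho : fderiv ℝ g =o[𝓝 0] fun x => ‖x‖ ^ n) : g =o[𝓝 0] fun x => ‖x‖ ^ (n + 1) := by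
  rw [isLittleO_iff] at ho ⊢
  intro ε hε
  obtain ⟨r, hr, hball⟩ := Metric.eventually_nhds_iff_ball.1 (hd.and (ho hε))
  filter_upwards [Metric.ball_mem_nhds (0 : X) hr] with x hx
  have hsub : Metric.closedBall (0 : X) ‖x‖ ⊆ Metric.ball 0 r :=
    Metric.closedBall_subset_ball (by simpa using hx)
  have := (convex_closedBall (0 : X) ‖x‖).norm_image_sub_le_of_norm_fderiv_le (𝕜 := ℝ) (f := g)
    (C := ε * ‖x‖ ^ n) (fun y hy => (hball y (hsub hy)).1) (fun y hy => by
      have h1 := (hball y (hsub hy)).2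
      refine h1.trans ?_
      have : ‖y‖ ≤ ‖x‖ := by simpa using hy
      simp only [norm_pow, norm_norm]
      gcongr) (x := 0) (y := x) (by simp) (by simp)
  simpa [h0, pow_succ, mul_assoc] using this

theorem ContDiffAt.taylor_two_isLittleO {F : X → Y} (hF : ContDiffAt ℝ ∞ F 0) :
    (fun x => F x - (F 0 + fderiv ℝ F 0 x + (1 / 2 : ℝ) • fderiv ℝ (fderiv ℝ F) 0 x x))
      =o[𝓝 0] fun x => ‖x‖ ^ 2 := by
  set F1 := fderiv ℝ F 0
  set F2 := fderiv ℝ (fderiv ℝ F) 0 with hF2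
  have hpoly (x : X) : HasFDerivAt (fun x => F 0 + F1 x + (1 / 2 : ℝ) • F2 x x) (F1 + F2 x) x := by
    have h := ((F1.hasFDerivAt (x := x)).const_add (F 0)).add
      (((F2.hasFDerivAt (x := x)).clm_apply (hasFDerivAt_id x)).const_smul (1 / 2 : ℝ))
    refine h.congr_fderiv ?_
    ext u
    have := hF.fderiv_fderiv_symm u x
    simp only [← hF2] at this
    simp [this, ← add_smul]
    module
  refine isLittleO_pow_succ_of_fderiv (n := 1) (by simp) ?_ ?_
  · filter_upwards [hF.eventually_differentiableAt] with x hx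
    exact hx.sub (hpoly x).differentiableAt
  · have h := hF.fderiv_infty.differentiableAt_infty.hasFDerivAt.isLittleO
    simp only [sub_zero, pow_one] at h ⊢
    refine (h.congr' ?_ .rfl).norm_right
    filter_upwards [hF.eventually_differentiableAt] with x hx
    rw [(hx.hasFDerivAt.fun_sub (hpoly x)).fderiv]
    simp only [F1, F2]
    abel

theorem ContDiffAt.taylor_three_isLittleO {F : X → Y} (hF : ContDiffAt ℝ ∞ F 0) :
    (fun x => F x - (F 0 + fderiv ℝ F 0 x + (1 / 2 : ℝ) • fderiv ℝ (fderiv ℝ F) 0 x x +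
      (1 / 6 : ℝ) • fderiv ℝ (fderiv ℝ (fderiv ℝ F)) 0 x x x)) =o[𝓝 0] fun x => ‖x‖ ^ 3 := by
  set F1 := fderiv ℝ F 0
  set F2 := fderiv ℝ (fderiv ℝ F) 0 with hF2
  set F3 := fderiv ℝ (fderiv ℝ (fderiv ℝ F)) 0 with hF3
  have hpoly (x : X) : HasFDerivAt (fun x => F 0 + F1 x + (1 / 2 : ℝ) • F2 x x +
      (1 / 6 : ℝ) • F3 x x x) (F1 + F2 x + (1 / 2 : ℝ) • F3 x x) x := by
    have h := (((F1.hasFDerivAt (x := x)).const_add (F 0)).add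
      (((F2.hasFDerivAt (x := x)).clm_apply (hasFDerivAt_id x)).const_smul (1 / 2 : ℝ))).add
      ((((F3.hasFDerivAt (x := x)).clm_apply (hasFDerivAt_id x)).clm_apply
        (hasFDerivAt_id x)).const_smul (1 / 6 : ℝ))
    refine h.congr_fderiv ?_
    ext u
    have h2 := hF.fderiv_fderiv_symm u x
    have h3 := hF.fderiv_fderiv_fderiv_symm_left u x x
    have h4 := hF.fderiv_fderiv_fderiv_symm_right x u x
    simp only [← hF2, ← hF3] at h2 h3 h4
    simp [h2, h3, h4]
    module
  refine isLittleO_pow_succ_of_fderiv (n := 2) (by simp) ?_ ?_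
  · filter_upwards [hF.eventually_differentiableAt] with x hx
    exact hx.sub (hpoly x).differentiableAt
  · refine hF.fderiv_infty.taylor_two_isLittleO.congr' ?_ .rfl
    filter_upwards [hF.eventually_differentiableAt] with x hx
    rw [(hx.hasFDerivAt.fun_sub (hpoly x)).fderiv]

end Taylor

/-! ### Third-order jets of curves -/

section Jets

variable {X Y Z : Type*} [NormedAddCommGroup X] [NormedSpace ℝ X]
  [NormedAddCommGroup Y] [NormedSpace ℝ Y] [NormedAddCommGroup Z] [NormedSpace ℝ Z]

/-- The curve `f` has the expansion `f t = t a + t² b + t³ c + o(t³)` at `0`. -/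
def HasCubicJet (f : ℝ → X) (a b c : X) : Prop :=
  ∃ k : ℝ → X, Tendsto k (𝓝 0) (𝓝 c) ∧ ∀ᶠ t in 𝓝 (0 : ℝ), f t = t • a + t ^ 2 • b + t ^ 3 • k t

namespace HasCubicJet

theorem congr' {f g : ℝ → X} {a b c : X} (hf : HasCubicJet f a b c) (h : f =ᶠ[𝓝 0] g) :
    HasCubicJet g a b c := by
  obtain ⟨k, hk, hfk⟩ := hf
  exact ⟨k, hk, by filter_upwards [hfk, h] with t h1 h2 using h2 ▸ h1⟩

theorem congr_coeff {f : ℝ → X} {a b c a' b' c' : X} (hf : HasCubicJet f a b c) (ha : a = a')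
    (hb : b = b') (hc : c = c') : HasCubicJet f a' b' c' := by
  subst ha hb hc; exact hf

theorem line (x : X) : HasCubicJet (fun t => t • x) x 0 0 :=
  ⟨fun _ => 0, tendsto_const_nhds, by simp⟩

theorem add {f g : ℝ → X} {a b c a' b' c' : X} (hf : HasCubicJet f a b c)
    (hg : HasCubicJet g a' b' c') :
    HasCubicJet (fun t => f t + g t) (a + a') (b + b') (c + c') := by
  obtain ⟨k, hk, hfk⟩ := hf
  obtain ⟨l, hl, hgl⟩ := hg
  refine ⟨fun t => k t + l t, hk.add hl, ?_⟩
  filter_upwards [hfk, hgl] with t h1 h2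
  rw [h1, h2]; module

theorem smul {f : ℝ → X} {a b c : X} (hf : HasCubicJet f a b c) (r : ℝ) :
    HasCubicJet (fun t => r • f t) (r • a) (r • b) (r • c) := by
  obtain ⟨k, hk, hfk⟩ := hf
  refine ⟨fun t => r • k t, hk.const_smul r, ?_⟩
  filter_upwards [hfk] with t h1
  rw [h1]; module

theorem clm {f : ℝ → X} {a b c : X} (hf : HasCubicJet f a b c) (L : X →L[ℝ] Y) :
    HasCubicJet (fun t => L (f t)) (L a) (L b) (L c) := by
  obtain ⟨k, hk, hfk⟩ := hf
  refine ⟨fun t => L (k t), (L.continuous.tendsto c).comp hk, ?_⟩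
  filter_upwards [hfk] with t h1
  simp [h1]

theorem prodMk {f : ℝ → X} {g : ℝ → Y} {a b c : X} {a' b' c' : Y} (hf : HasCubicJet f a b c)
    (hg : HasCubicJet g a' b' c') :
    HasCubicJet (fun t => (f t, g t)) (a, a') (b, b') (c, c') := by
  obtain ⟨k, hk, hfk⟩ := hf
  obtain ⟨l, hl, hgl⟩ := hg
  refine ⟨fun t => (k t, l t), hk.prodMk_nhds hl, ?_⟩
  filter_upwards [hfk, hgl] with t h1 h2
  rw [h1, h2]; simp

theorem bilin {f : ℝ → X} {g : ℝ → Y} {a b c : X} {a' b' c' : Y} (hf : HasCubicJet f a b c)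
    (hg : HasCubicJet g a' b' c') (B : X →L[ℝ] Y →L[ℝ] Z) :
    HasCubicJet (fun t => B (f t) (g t)) 0 (B a a') (B a b' + B b a') := by
  obtain ⟨k, hk, hfk⟩ := hf
  obtain ⟨l, hl, hgl⟩ := hg
  refine ⟨fun t => B a b' + B b a' + t • (B a (l t) + B b b' + B (k t) a') +
    t ^ 2 • (B b (l t) + B (k t) b') + t ^ 3 • B (k t) (l t), ?_, ?_⟩
  · have hid : Tendsto (fun t : ℝ => t) (𝓝 0) (𝓝 0) := tendsto_id
    have hkl : Tendsto (fun t => B (k t) (l t)) (𝓝 0) (𝓝 (B c c')) :=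
      (B.continuous₂.tendsto (c, c')).comp (hk.prodMk_nhds hl)
    have hal (x : X) : Tendsto (fun t => B x (l t)) (𝓝 0) (𝓝 (B x c')) :=
      ((B x).continuous.tendsto c').comp hl
    have hka (y : Y) : Tendsto (fun t => B (k t) y) (𝓝 0) (𝓝 (B c y)) :=
      (B.continuous₂.tendsto (c, y)).comp (hk.prodMk_nhds tendsto_const_nhds)
    have := (((tendsto_const_nhds (x := B a b' + B b a') (f := 𝓝 (0 : ℝ))).add
      (hid.smul (((hal a).add (tendsto_const_nhds (x := B b b'))).add (hka a')))).add
      ((hid.pow 2).smul ((hal b).add (hka b')))).add ((hid.pow 3).smul hkl)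
    simpa using this
  · filter_upwards [hfk, hgl] with t h1 h2
    rw [h1, h2]
    simp only [map_add, map_smul, add_apply, smul_apply]
    module

theorem weaken_isBigO {f : ℝ → X} {a b c : X} (hf : HasCubicJet f a b c) :
    f =O[𝓝 0] (fun t : ℝ => t) := by
  obtain ⟨k, hk, hfk⟩ := hf
  have hid : Tendsto (fun t : ℝ => t) (𝓝 0) (𝓝 0) := tendsto_id
  have h1 : Tendsto (fun t : ℝ => a + t • b + t ^ 2 • k t) (𝓝 0) (𝓝 a) := by
    have := ((tendsto_const_nhds (x := a) (f := 𝓝 (0 : ℝ))).add (hid.smul_const b)).add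
      ((hid.pow 2).smul hk)
    simpa using this
  have h2 := (Asymptotics.isBigO_refl (fun t : ℝ => t) (𝓝 0)).smul (h1.isBigO_one ℝ)
  refine h2.congr' ?_ (by simp)
  filter_upwards [hfk] with t ht
  rw [ht]; module

theorem tendsto_zero {f : ℝ → X} {a b c : X} (hf : HasCubicJet f a b c) :
    Tendsto f (𝓝 0) (𝓝 0) :=
  hf.weaken_isBigO.trans_tendsto tendsto_id

theorem of_isLittleO {f : ℝ → X} (hf : f =o[𝓝 0] fun t : ℝ => t ^ 3) : HasCubicJet f 0 0 0 := by
  refine ⟨fun t => (t ^ 3)⁻¹ • f t, ?_, ?_⟩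
  · rw [tendsto_zero_iff_norm_tendsto_zero]
    have := hf.norm_left.tendsto_div_nhds_zero.norm
    simpa [norm_smul, div_eq_inv_mul] using this
  · filter_upwards [hf.def one_pos] with t ht
    rcases eq_or_ne t 0 with rfl | h0
    · simpa using ht
    · simp [h0]

/-- The device that turns an equation between germs into identities between derivatives: expand both
sides along a line and compare coefficients. -/
theorem coeff_unique {f : ℝ → X} {a b c a' b' c' : X} (hf : HasCubicJet f a b c)
    (hg : HasCubicJet f a' b' c') : a = a' ∧ b = b' ∧ c = c' := by
  obtain ⟨k, hk, hfk⟩ := hf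
  obtain ⟨l, hl, hgl⟩ := hg
  have hid : Tendsto (fun t : ℝ => t) (𝓝[≠] 0) (𝓝 0) := tendsto_id.mono_left nhdsWithin_le_nhds
  have hkl : Tendsto (fun t => k t - l t) (𝓝[≠] 0) (𝓝 (c - c')) :=
    (hk.sub hl).mono_left nhdsWithin_le_nhds
  have h : ∀ᶠ t in 𝓝[≠] (0 : ℝ), t • (a - a') + t ^ 2 • (b - b') + t ^ 3 • (k t - l t) = 0 := by
    filter_upwards [hfk.filter_mono nhdsWithin_le_nhds, hgl.filter_mono nhdsWithin_le_nhds]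
      with t h1 h2
    have := h1.symm.trans h2
    rw [← sub_eq_zero] at this
    rw [← this]; module
  have key (n : ℕ) (u : X) (w : ℝ → X) (hw : Tendsto w (𝓝[≠] 0) (𝓝 u))
      (h : ∀ᶠ t in 𝓝[≠] (0 : ℝ), t ^ n • w t = 0) : u = 0 := by
    refine tendsto_nhds_unique hw (tendsto_const_nhds.congr' ?_)
    filter_upwards [h, self_mem_nhdsWithin] with t h1 h2
    have : t ≠ 0 := h2
    exact ((smul_eq_zero.1 h1).resolve_left (pow_ne_zero _ this)).symm
  have ha : a - a' = 0 := by
    refine key 1 _ (fun t => (a - a') + t • (b - b') + t ^ 2 • (k t - l t)) ?_ ?_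
    · have := ((tendsto_const_nhds (x := a - a') (f := 𝓝[≠] (0 : ℝ))).add
        (hid.smul_const (b - b'))).add ((hid.pow 2).smul hkl)
      simpa using this
    · filter_upwards [h] with t ht
      rw [← ht]; module
  have hb : b - b' = 0 := by
    refine key 2 _ (fun t => (b - b') + t • (k t - l t)) ?_ ?_
    · have := (tendsto_const_nhds (x := b - b') (f := 𝓝[≠] (0 : ℝ))).add (hid.smul hkl)
      simpa using this
    · filter_upwards [h] with t ht
      rw [← ht, ha]; module
  have hc : c - c' = 0 := by
    refine key 3 _ _ hkl ?_
    filter_upwards [h] with t ht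
    rw [← ht, ha, hb]; module
  exact ⟨sub_eq_zero.1 ha, sub_eq_zero.1 hb, sub_eq_zero.1 hc⟩

/-- The third order chain rule. -/
theorem comp_contDiffAt {f : ℝ → X} {a b c : X} (hf : HasCubicJet f a b c) {F : X → Y}
    (hF : ContDiffAt ℝ ∞ F 0) (h0 : F 0 = 0) :
    HasCubicJet (fun t => F (f t)) (fderiv ℝ F 0 a)
      (fderiv ℝ F 0 b + (1 / 2 : ℝ) • fderiv ℝ (fderiv ℝ F) 0 a a)
      (fderiv ℝ F 0 c + fderiv ℝ (fderiv ℝ F) 0 a b +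
        (1 / 6 : ℝ) • fderiv ℝ (fderiv ℝ (fderiv ℝ F)) 0 a a a) := by
  have hsymm := hF.fderiv_fderiv_symm
  have hT := hF.taylor_three_isLittleO
  set F1 := fderiv ℝ F 0
  set F2 := fderiv ℝ (fderiv ℝ F) 0
  set F3 := fderiv ℝ (fderiv ℝ (fderiv ℝ F)) 0
  have hrem : HasCubicJet (fun t => F (f t) - (F 0 + F1 (f t) + (1 / 2 : ℝ) • F2 (f t) (f t) +
      (1 / 6 : ℝ) • F3 (f t) (f t) (f t))) 0 0 0 := by
    refine of_isLittleO ?_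
    exact (hT.comp_tendsto hf.tendsto_zero).trans_isBigO (hf.weaken_isBigO.norm_left.pow 3)
  -- The cubic term is treated as two successive bilinear ones, the second being the evaluation
  -- pairing, i.e. the identity map of `X →L[ℝ] Y`.
  have h3 := (((hf.bilin hf F3).bilin hf (ContinuousLinearMap.id ℝ (X →L[ℝ] Y))).smul (1 / 6 : ℝ))
  have h := ((hrem.add (hf.clm F1)).add ((hf.bilin hf F2).smul (1 / 2 : ℝ))).add h3
  refine (h.congr' (.of_forall fun t => ?_)).congr_coeff ?_ ?_ ?_
  · simp [h0]
    abel
  · simp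
  · simp
  · have := hsymm a b
    simp [this]
    module

end HasCubicJet

theorem ContDiffAt.exists_hasCubicJet {F : X → Y} (hF : ContDiffAt ℝ ∞ F 0) (h0 : F 0 = 0)
    {f : ℝ → X} {a b c : X} (hf : HasCubicJet f a b c) :
    ∃ a' b' c', HasCubicJet (fun t => F (f t)) a' b' c' :=
  ⟨_, _, _, hf.comp_contDiffAt hF h0⟩

end Jets

/-! ### Operations with unit, and Baker–Campbell–Hausdorff to third order -/

section UnitalJets

variable {X W Z : Type*} [NormedAddCommGroup X] [NormedSpace ℝ X]
  [NormedAddCommGroup W] [NormedSpace ℝ W] [NormedAddCommGroup Z] [NormedSpace ℝ Z]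

/-- Precomposition of a trilinear map with three linear maps. -/
def ContinuousLinearMap.trilinearComp (T : W →L[ℝ] W →L[ℝ] W →L[ℝ] Z) (f g h : X →L[ℝ] W) :
    X →L[ℝ] X →L[ℝ] X →L[ℝ] Z :=
  ((ContinuousLinearMap.compL ℝ X W (X →L[ℝ] Z)).flip g).comp
    ((ContinuousLinearMap.compL ℝ W (W →L[ℝ] Z) (X →L[ℝ] Z)
      ((ContinuousLinearMap.compL ℝ X W Z).flip h)).comp (T.comp f))

/-- A germ at `(0, 0)` of a smooth binary operation with unit `0`. -/
structure IsUnitalGerm (F : X × X → X) : Prop where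
  contDiffAt : ContDiffAt ℝ ∞ F 0
  right_unit : ∀ᶠ x in 𝓝 (0 : X), F (x, 0) = x
  left_unit : ∀ᶠ y in 𝓝 (0 : X), F (0, y) = y

/-- The mixed second derivative `∂²F/∂x∂y` at `(0, 0)`. -/
def mixedXY (F : X × X → Z) : X →L[ℝ] X →L[ℝ] Z :=
  (fderiv ℝ (fderiv ℝ F) 0).bilinearComp (.inl ℝ X X) (.inr ℝ X X)

/-- The mixed third derivative `∂³F/∂x∂x∂y` at `(0, 0)`. -/
def mixedXXY (F : X × X → Z) : X →L[ℝ] X →L[ℝ] X →L[ℝ] Z :=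
  (fderiv ℝ (fderiv ℝ (fderiv ℝ F)) 0).trilinearComp (.inl ℝ X X) (.inl ℝ X X) (.inr ℝ X X)

/-- The mixed third derivative `∂³F/∂x∂y∂y` at `(0, 0)`. -/
def mixedXYY (F : X × X → Z) : X →L[ℝ] X →L[ℝ] X →L[ℝ] Z :=
  (fderiv ℝ (fderiv ℝ (fderiv ℝ F)) 0).trilinearComp (.inl ℝ X X) (.inr ℝ X X) (.inr ℝ X X)

theorem mixedXY_apply (F : X × X → Z) (x y : X) :
    mixedXY F x y = fderiv ℝ (fderiv ℝ F) 0 (x, 0) (0, y) := rfl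

theorem mixedXXY_apply (F : X × X → Z) (x y z : X) :
    mixedXXY F x y z = fderiv ℝ (fderiv ℝ (fderiv ℝ F)) 0 (x, 0) (y, 0) (0, z) := rfl

theorem mixedXYY_apply (F : X × X → Z) (x y z : X) :
    mixedXYY F x y z = fderiv ℝ (fderiv ℝ (fderiv ℝ F)) 0 (x, 0) (0, y) (0, z) := rfl

namespace IsUnitalGerm

variable {F : X × X → X}

theorem map_zero (hF : IsUnitalGerm F) : F 0 = 0 :=
  hF.right_unit.self_of_nhds

theorem mixedXXY_symm (hF : IsUnitalGerm F) (x y z : X) :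
    mixedXXY F x y z = mixedXXY F y x z :=
  hF.contDiffAt.fderiv_fderiv_fderiv_symm_left _ _ _

theorem mixedXYY_symm (hF : IsUnitalGerm F) (x y z : X) :
    mixedXYY F x y z = mixedXYY F x z y :=
  hF.contDiffAt.fderiv_fderiv_fderiv_symm_right _ _ _

theorem tendsto_smul (x : X) : Tendsto (fun t : ℝ => t • x) (𝓝 0) (𝓝 0) :=
  (HasCubicJet.line x).tendsto_zero

/-- On the line t(x, 0) the operation is the identity, so the jet of `F` there is that of the line.
-/
theorem derivs_left (hF : IsUnitalGerm F) (x : X) : fderiv ℝ F 0 (x, 0) = x ∧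
    fderiv ℝ (fderiv ℝ F) 0 (x, 0) (x, 0) = 0 ∧
    fderiv ℝ (fderiv ℝ (fderiv ℝ F)) 0 (x, 0) (x, 0) (x, 0) = 0 := by
  have h1 := (HasCubicJet.line ((x, 0) : X × X)).comp_contDiffAt hF.contDiffAt hF.map_zero
  have h2 := (HasCubicJet.line x).congr' (g := fun t => F (t • (x, 0))) (by
    filter_upwards [(tendsto_smul x).eventually hF.right_unit] with t ht
    simpa using ht.symm)
  obtain ⟨ha, hb, hc⟩ := h1.coeff_unique h2
  simp only [_root_.map_zero, zero_add] at ha hb hc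
  exact ⟨ha, (smul_eq_zero.1 hb).resolve_left (by norm_num),
    (smul_eq_zero.1 hc).resolve_left (by norm_num)⟩

theorem derivs_right (hF : IsUnitalGerm F) (x : X) : fderiv ℝ F 0 (0, x) = x ∧
    fderiv ℝ (fderiv ℝ F) 0 (0, x) (0, x) = 0 ∧
    fderiv ℝ (fderiv ℝ (fderiv ℝ F)) 0 (0, x) (0, x) (0, x) = 0 := by
  have h1 := (HasCubicJet.line ((0, x) : X × X)).comp_contDiffAt hF.contDiffAt hF.map_zero
  have h2 := (HasCubicJet.line x).congr' (g := fun t => F (t • (0, x))) (by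
    filter_upwards [(tendsto_smul x).eventually hF.left_unit] with t ht
    simpa using ht.symm)
  obtain ⟨ha, hb, hc⟩ := h1.coeff_unique h2
  simp only [_root_.map_zero, zero_add] at ha hb hc
  exact ⟨ha, (smul_eq_zero.1 hb).resolve_left (by norm_num),
    (smul_eq_zero.1 hc).resolve_left (by norm_num)⟩

theorem fderiv_apply (hF : IsUnitalGerm F) (x y : X) : fderiv ℝ F 0 (x, y) = x + y := by
  have : ((x, y) : X × X) = (x, 0) + (0, y) := by simp
  rw [this, map_add, (hF.derivs_left x).1, (hF.derivs_right y).1]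

/-- The pure blocks of the second derivative vanish on the diagonal, hence everywhere by
polarisation; only the mixed block remains. -/
theorem fderiv_fderiv_apply (hF : IsUnitalGerm F) (x y x' y' : X) :
    fderiv ℝ (fderiv ℝ F) 0 (x, y) (x', y') = mixedXY F x y' + mixedXY F x' y := by
  have hs := hF.contDiffAt.fderiv_fderiv_symm
  set T := fderiv ℝ (fderiv ℝ F) 0 with hT
  have hl : T (x, 0) (x', 0) = 0 := by
    have h := (hF.derivs_left (x + x')).2.1
    have hx := (hF.derivs_left x).2.1
    have hx' := (hF.derivs_left x').2.1
    have e : ((x + x', 0) : X × X) = (x, 0) + (x', 0) := by simp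
    rw [e] at h
    simp only [map_add, add_apply, ← hT, hs (x', 0) (x, 0)] at h hx hx'
    linear_combination (norm := module) (1 / 2 : ℝ) • (h - hx - hx')
  have hr : T (0, y) (0, y') = 0 := by
    have h := (hF.derivs_right (y + y')).2.1
    have hy := (hF.derivs_right y).2.1
    have hy' := (hF.derivs_right y').2.1
    have e : ((0, y + y') : X × X) = (0, y) + (0, y') := by simp
    rw [e] at h
    simp only [map_add, add_apply, ← hT, hs (0, y') (0, y)] at h hy hy'
    linear_combination (norm := module) (1 / 2 : ℝ) • (h - hy - hy')
  have e1 : ((x, y) : X × X) = (x, 0) + (0, y) := by simp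
  have e2 : ((x', y') : X × X) = (x', 0) + (0, y') := by simp
  rw [e1, e2, mixedXY_apply, mixedXY_apply, ← hT, hs (x', 0) (0, y)]
  simp only [map_add, add_apply, hl, hr]
  abel

theorem fderiv_fderiv_fderiv_apply (hF : IsUnitalGerm F) (x y : X) :
    fderiv ℝ (fderiv ℝ (fderiv ℝ F)) 0 (x, y) (x, y) (x, y) =
      (3 : ℝ) • mixedXXY F x x y + (3 : ℝ) • mixedXYY F x y y := by
  have hl := hF.contDiffAt.fderiv_fderiv_fderiv_symm_left
  have hr := hF.contDiffAt.fderiv_fderiv_fderiv_symm_right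
  have h1 := (hF.derivs_left x).2.2
  have h2 := (hF.derivs_right y).2.2
  rw [mixedXXY_apply, mixedXYY_apply]
  set T := fderiv ℝ (fderiv ℝ (fderiv ℝ F)) 0
  have e1 : ((x, y) : X × X) = (x, 0) + (0, y) := by simp
  rw [e1]
  simp only [map_add, add_apply, h1, h2]
  rw [hr (x, 0) (0, y) (x, 0), hl (0, y) (x, 0) (x, 0), hr (x, 0) (0, y) (x, 0),
    hr (0, y) (0, y) (x, 0), hl (0, y) (x, 0) (0, y)]
  module

/-- The third order expansion of a binary operation with unit `0`. -/
theorem hasCubicJet (hF : IsUnitalGerm F) {u v : ℝ → X} {a b c a' b' c' : X}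
    (hu : HasCubicJet u a b c) (hv : HasCubicJet v a' b' c') :
    HasCubicJet (fun t => F (u t, v t)) (a + a') (b + b' + mixedXY F a a')
      (c + c' + mixedXY F a b' + mixedXY F b a' + (1 / 2 : ℝ) • mixedXXY F a a a' +
        (1 / 2 : ℝ) • mixedXYY F a a' a') := by
  refine ((hu.prodMk hv).comp_contDiffAt hF.contDiffAt hF.map_zero).congr_coeff ?_ ?_ ?_
  · rw [hF.fderiv_apply]
  · rw [hF.fderiv_apply, hF.fderiv_fderiv_apply]
    module
  · rw [hF.fderiv_apply, hF.fderiv_fderiv_apply, hF.fderiv_fderiv_fderiv_apply]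
    module

theorem eventually_lines {P : X × X × X → Prop} (h : ∀ᶠ p in 𝓝 0, P p) (x y z : X) :
    ∀ᶠ t in 𝓝 (0 : ℝ), P (t • x, t • y, t • z) := by
  have := (HasCubicJet.line ((x, y, z) : X × X × X)).tendsto_zero.eventually h
  simpa using this

/-- Comparison of the trilinear terms in the associativity law. -/
theorem assoc_mixed (hF : IsUnitalGerm F)
    (hassoc : ∀ᶠ p : X × X × X in 𝓝 0, F (F (p.1, p.2.1), p.2.2) = F (p.1, F (p.2.1, p.2.2)))
    (x y z : X) : mixedXY F (mixedXY F x y) z + mixedXXY F x y z =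
      mixedXY F x (mixedXY F y z) + mixedXYY F x y z := by
  have hx := HasCubicJet.line x
  have hy := HasCubicJet.line y
  have hz := HasCubicJet.line z
  have h1 := hF.hasCubicJet (hF.hasCubicJet hx hy) hz
  have h2 := hF.hasCubicJet hx (hF.hasCubicJet hy hz)
  have h := (h1.congr' (eventually_lines hassoc x y z)).coeff_unique h2
  have h3 := h.2.2
  -- In the two cubic coefficients the terms that are not trilinear in x, y, z agree identically, so
  -- no polarisation is needed.
  simp only [map_add, add_apply, _root_.map_zero, zero_apply, zero_add, add_zero] at h3
  rw [hF.mixedXXY_symm y x z, hF.mixedXYY_symm x z y] at h3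
  linear_combination (norm := module) h3

theorem doubling_mixed (hF : IsUnitalGerm F) (hdouble : ∀ᶠ x in 𝓝 (0 : X), F (x, x) = (2 : ℝ) • x)
    (x : X) : mixedXY F x x = 0 ∧ mixedXXY F x x x + mixedXYY F x x x = 0 := by
  have hx := HasCubicJet.line x
  have h := ((hF.hasCubicJet hx hx).congr' ((tendsto_smul x).eventually hdouble)).coeff_unique
    (hx.smul 2)
  have h2 := h.2.1
  have h3 := h.2.2
  simp only [_root_.map_zero, zero_apply, zero_add, smul_zero] at h2 h3
  refine ⟨h2, ?_⟩
  linear_combination (norm := module) (2 : ℝ) • h3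

end IsUnitalGerm

/-- A germ of a local group law in which the lines through `0` are one-parameter subgroups. -/
structure IsNormalGroupGerm (F : X × X → X) : Prop extends IsUnitalGerm F where
  assoc : ∀ᶠ p : X × X × X in 𝓝 0, F (F (p.1, p.2.1), p.2.2) = F (p.1, F (p.2.1, p.2.2))
  double : ∀ᶠ x in 𝓝 (0 : X), F (x, x) = (2 : ℝ) • x

namespace IsNormalGroupGerm

variable {F : X × X → X}

theorem mixedXY_antisymm (hF : IsNormalGroupGerm F) (x y : X) :
    mixedXY F x y = -mixedXY F y x := by
  have h := hF.doubling_mixed hF.double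
  have h1 := (h (x + y)).1
  simp only [map_add, add_apply, (h _).1] at h1
  linear_combination (norm := module) h1

/-- On the diagonal, doubling gives C + D = 0 and associativity, where A(x, x) = 0, gives C = D. -/
theorem cubic_diag (hF : IsNormalGroupGerm F) (x : X) :
    mixedXXY F x x x = 0 ∧ mixedXYY F x x x = 0 := by
  have h := hF.doubling_mixed hF.double x
  have h2 := hF.assoc_mixed hF.assoc x x x
  simp only [h.1, map_zero, zero_apply, zero_add] at h2
  constructor
  · linear_combination (norm := module) (1 / 2 : ℝ) • h.2 + (1 / 2 : ℝ) • h2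
  · linear_combination (norm := module) (1 / 2 : ℝ) • h.2 - (1 / 2 : ℝ) • h2

/-- A linear system in C(x,x,z), C(x,z,x), D(x,x,z), D(z,x,x): the vanishing on the diagonal,
polarised, gives two equations, and associativity at (x,x,z) and (x,z,x) gives the other two. The
value 2/3 is the coefficient 1/12 of [x,[x,z]] in the Baker–Campbell–Hausdorff series, once C is
halved and [·,·] = 2A. -/
theorem cubic_aux (hF : IsNormalGroupGerm F) (x z : X) :
    mixedXXY F x x z = (2 / 3 : ℝ) • mixedXY F x (mixedXY F x z) ∧
    mixedXYY F z x x = (2 / 3 : ℝ) • mixedXY F x (mixedXY F x z) := by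
  have hC : mixedXXY F x x z + (2 : ℝ) • mixedXXY F x z x = 0 := by
    have h1 := (hF.cubic_diag (x + z)).1
    have h2 := (hF.cubic_diag (x - z)).1
    simp only [map_add, map_sub, add_apply, sub_apply, (hF.cubic_diag _).1,
      hF.mixedXXY_symm z x] at h1 h2
    linear_combination (norm := module) (1 / 2 : ℝ) • h1 - (1 / 2 : ℝ) • h2
  have hD : mixedXYY F z x x + (2 : ℝ) • mixedXYY F x x z = 0 := by
    have h1 := (hF.cubic_diag (x + z)).2
    have h2 := (hF.cubic_diag (x - z)).2
    simp only [map_add, map_sub, add_apply, sub_apply, (hF.cubic_diag _).2,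
      hF.mixedXYY_symm _ z x] at h1 h2
    linear_combination (norm := module) (1 / 2 : ℝ) • h1 - (1 / 2 : ℝ) • h2
  have hxx := (hF.doubling_mixed hF.double x).1
  have h1 := hF.assoc_mixed hF.assoc x x z
  have h2 := hF.assoc_mixed hF.assoc x z x
  rw [hxx, map_zero, zero_apply] at h1
  rw [hF.mixedXY_antisymm (mixedXY F x z) x, hF.mixedXY_antisymm z x, map_neg,
    hF.mixedXYY_symm x z x] at h2
  constructor
  · linear_combination (norm := module) (2 / 3 : ℝ) • h1 - (2 / 3 : ℝ) • h2 + (1 / 3 : ℝ) • hC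
  · linear_combination (norm := module) (2 / 3 : ℝ) • h1 + (4 / 3 : ℝ) • h2 - (2 / 3 : ℝ) • hC + hD

theorem mixedXXY_eq (hF : IsNormalGroupGerm F) (x y z : X) : mixedXXY F x y z =
    (1 / 3 : ℝ) • (mixedXY F x (mixedXY F y z) + mixedXY F y (mixedXY F x z)) := by
  have h := (hF.cubic_aux (x + y) z).1
  simp only [map_add, add_apply, (hF.cubic_aux _ _).1, hF.mixedXXY_symm y x] at h
  linear_combination (norm := module) (1 / 2 : ℝ) • h

theorem mixedXYY_eq (hF : IsNormalGroupGerm F) (x y z : X) : mixedXYY F x y z =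
    (1 / 3 : ℝ) • (mixedXY F y (mixedXY F z x) + mixedXY F z (mixedXY F y x)) := by
  have h := (hF.cubic_aux (y + z) x).2
  simp only [map_add, add_apply, (hF.cubic_aux _ _).2, hF.mixedXYY_symm x z y] at h
  linear_combination (norm := module) (1 / 2 : ℝ) • h

/-- What remains of associativity after C and D are expressed through A. -/
theorem jacobi (hF : IsNormalGroupGerm F) (x y z : X) : mixedXY F y (mixedXY F x z) =
    mixedXY F x (mixedXY F y z) + mixedXY F z (mixedXY F x y) := by
  have h := hF.assoc_mixed hF.assoc x y z
  rw [hF.mixedXXY_eq, hF.mixedXYY_eq, hF.mixedXY_antisymm (mixedXY F x y) z,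
    hF.mixedXY_antisymm z x, hF.mixedXY_antisymm y x, map_neg, map_neg] at h
  linear_combination (norm := module) (3 / 2 : ℝ) • h

end IsNormalGroupGerm

end UnitalJets

/-! ### Chain rules and smooth local inverses at the origin -/

theorem ContDiffAt.fun_comp_of_eq {X Y Z : Type*} [NormedAddCommGroup X] [NormedSpace ℝ X]
    [NormedAddCommGroup Y] [NormedSpace ℝ Y] [NormedAddCommGroup Z] [NormedSpace ℝ Z]
    {g : Y → Z} {f : X → Y} {x : X} {y : Y} (hg : ContDiffAt ℝ ∞ g y) (hf : ContDiffAt ℝ ∞ f x)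
    (h : f x = y) : ContDiffAt ℝ ∞ (fun x => g (f x)) x := by
  subst h; exact hg.comp x hf

theorem HasFDerivAt.fun_comp_of_eq {X Y Z : Type*} [NormedAddCommGroup X] [NormedSpace ℝ X]
    [NormedAddCommGroup Y] [NormedSpace ℝ Y] [NormedAddCommGroup Z] [NormedSpace ℝ Z]
    {g : Y → Z} {f : X → Y} {x : X} {y : Y} {g' : Y →L[ℝ] Z} {f' : X →L[ℝ] Y}
    (hg : HasFDerivAt g g' y) (hf : HasFDerivAt f f' x) (h : f x = y) :
    HasFDerivAt (fun x => g (f x)) (g'.comp f') x := by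
  subst h; exact hg.comp x hf

section InverseFunction

variable {X Y : Type*} [NormedAddCommGroup X] [NormedSpace ℝ X] [CompleteSpace X]
  [NormedAddCommGroup Y] [NormedSpace ℝ Y]

theorem ContDiffAt.exists_local_inverse {f : X → Y} (hf : ContDiffAt ℝ ∞ f 0) (h0 : f 0 = 0)
    {e : X ≃L[ℝ] Y} (he : HasFDerivAt f (e : X →L[ℝ] Y) 0) :
    ∃ g : Y → X, ContDiffAt ℝ ∞ g 0 ∧ g 0 = 0 ∧ HasFDerivAt g (e.symm : Y →L[ℝ] X) 0 ∧
      (∀ᶠ x in 𝓝 0, g (f x) = x) ∧ ∀ᶠ y in 𝓝 0, f (g y) = y := by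
  have hs := hf.hasStrictFDerivAt' he (by simp)
  have h1 := hf.to_localInverse he (by simp)
  have h2 := hf.localInverse_apply_image he (by simp)
  have h3 := hs.to_localInverse.hasFDerivAt
  have h4 := hs.eventually_right_inverse
  rw [h0] at h1 h2 h3 h4
  exact ⟨_, h1, h2, h3, hs.eventually_left_inverse, h4⟩

end InverseFunction

/-! ### Smoothness of composition operators on continuous curves -/

section Nemytskii

universe u

variable {K : Type*} [TopologicalSpace K] [CompactSpace K]

section

variable {E F : Type*} [NormedAddCommGroup E] [NormedSpace ℝ E]
  [NormedAddCommGroup F] [NormedSpace ℝ F]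

/-- Pointwise application of a continuous family of linear maps to a continuous map. -/
def ContinuousMap.pointwiseApply :
    C(K, E →L[ℝ] F) →L[ℝ] C(K, E) →L[ℝ] C(K, F) :=
  LinearMap.mkContinuous₂
    (LinearMap.mk₂ ℝ (fun (A : C(K, E →L[ℝ] F)) (h : C(K, E)) =>
      (⟨fun t => A t (h t), by fun_prop⟩ : C(K, F)))
      (fun A A' h => by ext; simp) (fun c A h => by ext; simp)
      (fun A h h' => by ext; simp) (fun c A h => by ext; simp)) 1 (fun A h => by
      rw [one_mul, ContinuousMap.norm_le _ (by positivity)]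
      intro t
      exact (A t).le_of_opNorm_le_of_le (A.norm_coe_le_norm t) (h.norm_coe_le_norm t))

@[simp]
theorem ContinuousMap.pointwiseApply_apply (A : C(K, E →L[ℝ] F)) (h : C(K, E)) (t : K) :
    ContinuousMap.pointwiseApply A h t = A t (h t) := rfl

/-- Postcomposition with f' is continuous for the sup norm, so f' stays close to f'(γ t) along the
segment from γ t to γ t + h t, uniformly in t; the mean value inequality then bounds the remainder
pointwise. -/
theorem ContinuousMap.hasFDerivAt_postcomp {f : C(E, F)} (hf : Differentiable ℝ f)
    {f' : C(E, E →L[ℝ] F)} (hf' : ∀ x, fderiv ℝ f x = f' x) (γ : C(K, E)) :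
    HasFDerivAt (fun γ : C(K, E) => f.comp γ) (ContinuousMap.pointwiseApply (f'.comp γ)) γ := by
  rw [hasFDerivAt_iff_isLittleO_nhds_zero, Asymptotics.isLittleO_iff]
  intro ε hε
  have hcont := (f'.continuous_postcomp (X := K)).tendsto γ
  obtain ⟨δ, hδ, hball⟩ := Metric.eventually_nhds_iff.1
    (hcont.eventually_mem (Metric.closedBall_mem_nhds (f'.comp γ) hε))
  filter_upwards [Metric.ball_mem_nhds (0 : C(K, E)) hδ] with h hh
  have hh' : ‖h‖ < δ := by simpa using hh
  rw [ContinuousMap.norm_le _ (by positivity)]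
  intro t
  have key : ∀ z ∈ segment ℝ (γ t) (γ t + h t), ‖fderiv ℝ f z - f' (γ t)‖ ≤ ε := by
    rw [segment_eq_image']
    rintro _ ⟨s, hs, rfl⟩
    have h1 : dist (γ + s • h) γ < δ := by
      rw [dist_eq_norm, add_sub_cancel_left, norm_smul, Real.norm_of_nonneg hs.1]
      exact (mul_le_of_le_one_left (norm_nonneg _) hs.2).trans_lt hh'
    have h2 := hball h1
    rw [Metric.mem_closedBall] at h2
    have h3 := (ContinuousMap.dist_apply_le_dist t).trans h2
    simpa [hf', dist_eq_norm] using h3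
  have := Convex.norm_image_sub_le_of_norm_fderiv_le' (𝕜 := ℝ) (fun z _ => hf z) key
    (convex_segment _ _) (left_mem_segment ℝ _ _) (right_mem_segment ℝ _ _)
  rw [add_sub_cancel_left] at this
  exact this.trans (mul_le_mul_of_nonneg_left (h.norm_coe_le_norm t) hε.le)

end

/-- The derivative is again a composition operator, that of f', followed by a bounded bilinear map.
The induction changes the target from F to `E →L[ℝ] F`, hence the quantification over F and the
common universe. -/
theorem ContinuousMap.contDiff_postcomp_nat {E : Type u} [NormedAddCommGroup E] [NormedSpace ℝ E]
    (n : ℕ) : ∀ {F : Type u} [NormedAddCommGroup F] [NormedSpace ℝ F] (f : C(E, F)),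
      ContDiff ℝ n f → ContDiff ℝ n (fun γ : C(K, E) => f.comp γ) := by
  induction n with
  | zero =>
    intro F _ _ f _
    simpa using! f.continuous_postcomp (X := K)
  | succ n ih =>
    intro F _ _ f hf
    rw [Nat.cast_succ] at hf ⊢
    have hf1 := (contDiff_succ_iff_fderiv.1 hf).2.2
    let f' : C(E, E →L[ℝ] F) := ⟨fderiv ℝ f, hf1.continuous⟩
    rw [contDiff_succ_iff_hasFDerivAt]
    refine ⟨fun γ => ContinuousMap.pointwiseApply (f'.comp γ), ?_, fun γ => ?_⟩
    · exact ContinuousMap.pointwiseApply.contDiff.comp (ih f' hf1)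
    · exact ContinuousMap.hasFDerivAt_postcomp (hf.differentiable (by simp)) (fun _ => rfl) γ

/-- The composition operator `γ ↦ f ∘ γ` on continuous maps is smooth if `f` is. -/
theorem ContinuousMap.contDiff_postcomp {E F : Type u} [NormedAddCommGroup E] [NormedSpace ℝ E]
    [NormedAddCommGroup F] [NormedSpace ℝ F] (f : C(E, F)) (hf : ContDiff ℝ ∞ f) :
    ContDiff ℝ ∞ (fun γ : C(K, E) => f.comp γ) := by
  rw [contDiff_infty] at hf ⊢
  exact fun n => ContinuousMap.contDiff_postcomp_nat n f (hf n)

end Nemytskii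

/-! ### Smooth dependence of the time-one flow on a parameter -/

section Flow

open unitInterval

variable {E : Type*} [NormedAddCommGroup E] [NormedSpace ℝ E]

/-- The primitive vanishing at `0` of a continuous function on `[0, 1]`. -/
def primitiveL : C(I, E) →L[ℝ] C(I, E) :=
  LinearMap.mkContinuous
    { toFun := fun γ => ⟨fun t => ∫ s in (0 : ℝ)..t, IccExtend zero_le_one γ s,
        (intervalIntegral.continuous_primitive
          (fun a b => γ.continuous.Icc_extend'.intervalIntegrable a b) 0).comp
          continuous_subtype_val⟩
      map_add' := fun γ η => by
        ext t
        have := intervalIntegral.integral_add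
          (γ.continuous.Icc_extend' (h := zero_le_one).intervalIntegrable (μ := MeasureTheory.volume) 0 t)
          (η.continuous.Icc_extend' (h := zero_le_one).intervalIntegrable 0 t)
        simpa [IccExtend] using this
      map_smul' := fun c γ => by
        ext t
        simp [IccExtend] } 1 (fun γ => by
      rw [one_mul, ContinuousMap.norm_le _ (by positivity)]
      intro t
      have := intervalIntegral.norm_integral_le_of_norm_le_const (a := 0) (b := (t : ℝ))
        (f := IccExtend zero_le_one γ) (C := ‖γ‖) (fun s _ => γ.norm_coe_le_norm _)
      refine this.trans ?_
      rw [sub_zero, abs_of_nonneg t.2.1]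
      exact mul_le_of_le_one_right (norm_nonneg _) t.2.2)

theorem primitiveL_apply (γ : C(I, E)) (t : I) :
    primitiveL γ t = ∫ s in (0 : ℝ)..t, IccExtend zero_le_one γ s := rfl

/-- A pair `(ξ, γ)`, seen as the curve `t ↦ (ξ, γ t)`. -/
def constProdL : E × C(I, E) →L[ℝ] C(I, E × E) :=
  LinearMap.mkContinuous
    { toFun := fun p => ⟨fun t => (p.1, p.2 t), by fun_prop⟩
      map_add' := fun p q => by ext <;> simp
      map_smul' := fun c p => by ext <;> simp } 1 (fun p => by
      rw [one_mul, ContinuousMap.norm_le _ (by positivity)]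
      intro t
      exact max_le_max le_rfl (p.2.norm_coe_le_norm t))

@[simp]
theorem constProdL_apply (p : E × C(I, E)) (t : I) : constProdL p t = (p.1, p.2 t) := rfl

/-- A bump function cuts f off. The flow argument needs a globally defined field so that its
composition operator acts on all continuous curves. -/
theorem exists_contDiff_eventuallyEq {E F : Type*} [NormedAddCommGroup E] [NormedSpace ℝ E]
    [FiniteDimensional ℝ E] [NormedAddCommGroup F] [NormedSpace ℝ F] {f : E → F} {s : Set E}
    {x : E} (hs : s ∈ 𝓝 x) (hf : ContDiffOn ℝ ∞ f s) :
    ∃ g : E → F, ContDiff ℝ ∞ g ∧ g =ᶠ[𝓝 x] f := by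
  obtain ⟨r, hr, hrs⟩ := Metric.nhds_basis_closedBall.mem_iff.1 (interior_mem_nhds.2 hs)
  let χ : ContDiffBump x := ⟨r / 2, r, by positivity, by linarith⟩
  refine ⟨fun y => χ y • f y, ?_, ?_⟩
  · rw [contDiff_iff_contDiffAt]
    intro y
    by_cases hy : y ∈ tsupport χ
    · have hy' : y ∈ interior s := hrs (by simpa [χ.tsupport_eq] using hy)
      exact χ.contDiff.contDiffAt.smul (hf.contDiffAt (mem_interior_iff_mem_nhds.1 hy'))
    · refine (contDiffAt_const (c := (0 : F))).congr_of_eventuallyEq ?_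
      filter_upwards [(isClosed_tsupport χ).isOpen_compl.mem_nhds hy] with z hz
      simp [image_eq_zero_of_notMem_tsupport hz]
  · filter_upwards [χ.eventuallyEq_one] with y hy
    simp [hy]

/-- Smooth dependence on the parameter `ξ` near `0` of the time `1` point of the integral curve
issued from `0` of the vector field `X (ξ, ·)`, when `X (0, ·)` vanishes. -/
theorem exists_contDiffAt_flow [FiniteDimensional ℝ E] {X : E × E → E} {s : Set (E × E)}
    (hs : s ∈ 𝓝 0) (hX : ContDiffOn ℝ ∞ X s) (hX0 : ∀ᶠ g in 𝓝 (0 : E), X (0, g) = 0)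
    (hXid : ∀ ξ, X (ξ, 0) = ξ) :
    ∃ e : E → E, ContDiffAt ℝ ∞ e 0 ∧ e 0 = 0 ∧ HasFDerivAt e (.id ℝ E) 0 ∧
      ∀ W ∈ 𝓝 (0 : E), ∀ᶠ ξ in 𝓝 (0 : E), ∃ γ : ℝ → E, γ 0 = 0 ∧ γ 1 = e ξ ∧
        ∀ t ∈ Icc (0 : ℝ) 1, γ t ∈ W ∧ HasDerivWithinAt γ (X (ξ, γ t)) (Icc 0 1) t := by
  obtain ⟨Y, hY, hYX⟩ := exists_contDiff_eventuallyEq hs hX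
  let Yc : C(E × E, E) := ⟨Y, hY.continuous⟩
  let N : E × C(I, E) → C(I, E) := fun p => Yc.comp (constProdL p)
  have hN : ContDiff ℝ ∞ N := (Yc.contDiff_postcomp (K := I) hY).comp
    (constProdL (E := E)).contDiff
  have hY0 : Y 0 = 0 := by rw [hYX.self_of_nhds]; exact hXid 0
  have hN0 : N 0 = 0 := by ext t; simpa [N, Yc] using hY0
  have hYd : DifferentiableAt ℝ Y 0 := hY.contDiffAt.differentiableAt_infty
  -- Since X(0, ·) = 0, the derivative does not see g; this makes the linearised integral equation
  -- explicitly solvable.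
  have hDY (ξ g : E) : fderiv ℝ Y 0 (ξ, g) = ξ := by
    have h1 : fderiv ℝ Y 0 (ξ, 0) = ξ := by
      have h := hYd.hasFDerivAt.comp_hasDerivAt_of_eq (0 : ℝ)
        (f := fun t : ℝ => t • ((ξ, 0) : E × E)) ((hasDerivAt_id (0:ℝ)).smul_const _) (by simp)
      have h' : HasDerivAt (fun t : ℝ => t • ξ) ξ 0 := by
        simpa using (hasDerivAt_id (0 : ℝ)).smul_const ξ
      have heq : (Y ∘ fun t : ℝ => t • ((ξ, 0) : E × E)) =ᶠ[𝓝 0] fun t : ℝ => t • ξ := by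
        filter_upwards [(HasCubicJet.line ((ξ, 0) : E × E)).tendsto_zero.eventually hYX] with t ht
        simp only [Function.comp_apply, ht]
        simp [hXid]
      simpa using h.unique (h'.congr_of_eventuallyEq heq)
    have h2 : fderiv ℝ Y 0 (0, g) = 0 := by
      have h := hYd.hasFDerivAt.comp_hasDerivAt_of_eq (0 : ℝ)
        (f := fun t : ℝ => t • ((0, g) : E × E)) ((hasDerivAt_id (0:ℝ)).smul_const _) (by simp)
      have heq : (Y ∘ fun t : ℝ => t • ((0, g) : E × E)) =ᶠ[𝓝 0] fun t : ℝ => 0 := by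
        filter_upwards [(HasCubicJet.line ((0, g) : E × E)).tendsto_zero.eventually hYX,
          (HasCubicJet.line g).tendsto_zero.eventually hX0] with t ht ht'
        simp only [Function.comp_apply, ht]
        simpa using ht'
      simpa using h.unique ((hasDerivAt_const (0 : ℝ) (0 : E)).congr_of_eventuallyEq heq)
    have : ((ξ, g) : E × E) = (ξ, 0) + (0, g) := by simp
    rw [this, map_add, h1, h2, add_zero]
  let cst : E →L[ℝ] C(I, E) :=
    (ContinuousLinearMap.compLeftContinuous ℝ I (.fst ℝ E E)).comp
      (constProdL.comp (.inl ℝ E (C(I, E))))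
  have hcst (ξ : E) (t : I) : cst ξ t = ξ := rfl
  have hDN : HasFDerivAt N (cst.comp (.fst ℝ E (C(I, E)))) 0 := by
    let Y' : C(E × E, E × E →L[ℝ] E) := ⟨fderiv ℝ Y, (hY.continuous_fderiv (by simp))⟩
    have h := (Yc.hasFDerivAt_postcomp (hY.differentiable (by simp)) (f' := Y') (fun _ => rfl)
      (constProdL (0 : E × C(I, E)))).comp (0 : E × C(I, E))
      (constProdL (E := E)).hasFDerivAt
    refine h.congr_fderiv ?_
    refine ContinuousLinearMap.ext fun p => ContinuousMap.ext fun t => ?_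
    simp only [ContinuousLinearMap.comp_apply, ContinuousMap.pointwiseApply_apply,
      ContinuousMap.comp_apply, constProdL_apply, hcst]
    exact hDY _ _
  -- The integral equation γ = ∫ Y(ξ, γ) reads Ψ(ξ, γ) = (ξ, 0). The derivative of Ψ at 0 is the
  -- shear (ξ, γ) ↦ (ξ, γ - tξ), so a local inverse g of Ψ yields the solution curve as a smooth
  -- function of ξ.
  let Ψ : E × C(I, E) → E × C(I, E) := fun p => (p.1, p.2 - primitiveL (N p))
  have hΨ : ContDiff ℝ ∞ Ψ :=
    contDiff_fst.prodMk (contDiff_snd.sub ((primitiveL (E := E)).contDiff.comp hN))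
  have hΨ0 : Ψ 0 = 0 := by simp [Ψ, hN0]
  let M : E →L[ℝ] C(I, E) := primitiveL.comp cst
  let fw : E × C(I, E) →L[ℝ] E × C(I, E) :=
    (ContinuousLinearMap.fst ℝ E _).prod (.snd ℝ E _ - M.comp (.fst ℝ E _))
  let bw : E × C(I, E) →L[ℝ] E × C(I, E) :=
    (ContinuousLinearMap.fst ℝ E _).prod (.snd ℝ E _ + M.comp (.fst ℝ E _))
  let eqv : (E × C(I, E)) ≃L[ℝ] E × C(I, E) :=
    ContinuousLinearEquiv.equivOfInverse fw bw (fun p => by simp [fw, bw])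
      (fun p => by simp [fw, bw])
  have hDΨ : HasFDerivAt Ψ (eqv : E × C(I, E) →L[ℝ] E × C(I, E)) 0 := by
    have h := (hasFDerivAt_fst (𝕜 := ℝ) (p := (0 : E × C(I, E)))).prodMk
      ((hasFDerivAt_snd (𝕜 := ℝ) (p := (0 : E × C(I, E)))).fun_sub
        ((primitiveL (E := E)).hasFDerivAt.comp (0 : E × C(I, E)) hDN))
    exact h
  have : CompleteSpace E := FiniteDimensional.complete ℝ E
  obtain ⟨g, hg, hg0, hDg, -, hright⟩ := hΨ.contDiffAt.exists_local_inverse hΨ0 hDΨ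
  let ev : E × C(I, E) →L[ℝ] E :=
    (ContinuousMap.evalCLM ℝ (1 : I)).comp (.snd ℝ E (C(I, E)))
  have hin : ContDiffAt ℝ ∞ (fun ξ : E => g (ξ, 0)) 0 :=
    ContDiffAt.comp (0 : E) (f := fun ξ : E => ((ξ, 0) : E × C(I, E))) hg
      (by fun_prop)
  refine ⟨fun ξ => ev (g (ξ, 0)), ev.contDiff.contDiffAt.comp (0 : E) hin, ?_, ?_, ?_⟩
  · have : ((0, 0) : E × C(I, E)) = 0 := rfl
    simp [this, hg0]
  · have h1 : HasFDerivAt (fun ξ : E => g (ξ, 0)) _ 0 :=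
      HasFDerivAt.comp (0 : E) (f := fun ξ : E => ((ξ, 0) : E × C(I, E))) hDg
        (ContinuousLinearMap.inl ℝ E C(I, E)).hasFDerivAt
    refine (ev.hasFDerivAt.comp (0 : E) h1).congr_fderiv ?_
    ext ξ
    have h2 : eqv.symm (ξ, 0) = (ξ, M ξ) := by
      show bw (ξ, 0) = _
      simp [bw]
    have h3 : M ξ 1 = ξ := by
      show primitiveL (cst ξ) 1 = ξ
      rw [primitiveL_apply]
      have : IccExtend zero_le_one (cst ξ) = fun _ => ξ := rfl
      simp [this]
    simp only [ContinuousLinearMap.comp_apply, ContinuousLinearMap.inl_apply,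
      ContinuousLinearEquiv.coe_coe, h2, ContinuousLinearMap.id_apply]
    exact h3
  · intro W hW
    have hline : Tendsto (fun ξ : E => ((ξ, 0) : E × C(I, E))) (𝓝 0) (𝓝 0) := by
      have : Continuous (fun ξ : E => ((ξ, 0) : E × C(I, E))) := by fun_prop
      exact this.tendsto 0
    have hgt : Tendsto (fun ξ : E => g (ξ, 0)) (𝓝 0) (𝓝 0) := by
      have := hg.continuousAt.tendsto
      rw [hg0] at this
      exact this.comp hline
    -- For small ξ the curve is uniformly small, so it stays in W and in the region where the
    -- cut-off field is the original one.
    have hYXW : ∀ᶠ p : E × E in 𝓝 0, Y p = X p ∧ p.2 ∈ W :=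
      hYX.and ((continuous_snd.tendsto (0 : E × E)).eventually hW)
    obtain ⟨r, hr, hball⟩ := Metric.eventually_nhds_iff_ball.1 hYXW
    filter_upwards [hline.eventually hright, hgt.eventually (Metric.ball_mem_nhds _ hr)]
      with ξ hξ hsmall
    obtain ⟨h1, h2⟩ := Prod.ext_iff.1 hξ
    simp only [Ψ] at h1 h2
    set p := g (ξ, 0) with hp
    have h3 : p.2 = primitiveL (N p) := sub_eq_zero.1 h2
    have hpt (t : I) : (ξ, p.2 t) ∈ Metric.ball (0 : E × E) r := by
      rw [dist_zero_right] at hsmall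
      rw [mem_ball_zero_iff]
      refine lt_of_le_of_lt ?_ hsmall
      rw [← h1]
      exact max_le_max le_rfl (p.2.norm_coe_le_norm t)
    let γ : ℝ → E := fun t => ∫ s in (0 : ℝ)..t, IccExtend zero_le_one (N p) s
    have hγ (t : I) : γ t = p.2 t := by
      rw [h3]; rfl
    refine ⟨γ, by simp [γ], hγ 1, fun t ht => ?_⟩
    have ht' := hγ ⟨t, ht⟩
    simp only at ht'
    rw [ht']
    refine ⟨(hball _ (hpt _)).2, ?_⟩
    have hd := ((N p).continuous.Icc_extend' (h := zero_le_one)).integral_hasStrictDerivAt 0 t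
    have hval : IccExtend zero_le_one (N p) t = X (ξ, p.2 ⟨t, ht⟩) := by
      rw [IccExtend_of_mem _ _ ht, ← (hball _ (hpt ⟨t, ht⟩)).1, ← h1]
      rfl
    rw [← hval]
    exact hd.hasDerivAt.hasDerivWithinAt

end Flow

/-! ### Exponential map and logarithmic coordinates -/

namespace LocalLieGroup

variable {E : Type*} [NormedAddCommGroup E] [NormedSpace ℝ E] (G : LocalLieGroup E)

/-- The product of a local Lie group as a function of pairs. -/
def mulPair (p : E × E) : E := G.mul p.1 p.2

theorem U_mem_nhds : G.U ∈ 𝓝 (0 : E) :=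
  G.isOpen_U.mem_nhds (G.U₀_subset G.zero_mem_U₀)

theorem zero_mem_U : (0 : E) ∈ G.U := G.U₀_subset G.zero_mem_U₀

theorem contDiffAt_mulPair {g h : E} (hg : g ∈ G.U) (hh : h ∈ G.U) :
    ContDiffAt ℝ ∞ G.mulPair (g, h) :=
  G.contDiffOn_mul.contDiffAt ((G.isOpen_U.prod G.isOpen_U).mem_nhds ⟨hg, hh⟩)

theorem hasFDerivAt_mul_left {g h : E} (hg : g ∈ G.U) (hh : h ∈ G.U) :
    HasFDerivAt (fun y => G.mul g y)
      ((fderiv ℝ G.mulPair (g, h)).comp (.inr ℝ E E)) h :=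
  HasFDerivAt.comp h (g := G.mulPair) (f := fun y => (g, y))
    (G.contDiffAt_mulPair hg hh).differentiableAt_infty.hasFDerivAt (hasFDerivAt_prodMk_right g h)

theorem leftInvariantField_eq {g : E} (hg : g ∈ G.U) (ξ : E) :
    G.leftInvariantField ξ g = fderiv ℝ G.mulPair (g, 0) (0, ξ) := by
  rw [leftInvariantField, (G.hasFDerivAt_mul_left hg G.zero_mem_U).fderiv]
  rfl

theorem leftInvariantField_smul (c : ℝ) (ξ g : E) :
    G.leftInvariantField (c • ξ) g = c • G.leftInvariantField ξ g := by
  simp [leftInvariantField]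

theorem leftInvariantField_zero (g : E) : G.leftInvariantField 0 g = 0 := by
  simp [leftInvariantField]

theorem isUnitalGerm_mulPair : IsUnitalGerm G.mulPair where
  contDiffAt := G.contDiffAt_mulPair G.zero_mem_U G.zero_mem_U
  right_unit := by filter_upwards [G.U_mem_nhds] with x hx using G.mul_zero x hx
  left_unit := by filter_upwards [G.U_mem_nhds] with x hx using G.zero_mul x hx

theorem leftInvariantField_apply_zero (ξ : E) : G.leftInvariantField ξ 0 = ξ := by
  rw [G.leftInvariantField_eq G.zero_mem_U]
  exact (G.isUnitalGerm_mulPair.derivs_right ξ).1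

theorem contDiffOn_leftInvariantField :
    ContDiffOn ℝ ∞ (fun p : E × E => G.leftInvariantField p.1 p.2) (univ ×ˢ G.U) := by
  have h1 : ContDiffOn ℝ ∞ (fderiv ℝ G.mulPair) (G.U ×ˢ G.U) :=
    G.contDiffOn_mul.fderiv_of_isOpen (G.isOpen_U.prod G.isOpen_U) (by simp)
  have h2 : ContDiffOn ℝ ∞ (fun p : E × E => fderiv ℝ G.mulPair (p.2, 0)) (univ ×ˢ G.U) :=
    h1.comp (f := fun p : E × E => ((p.2, 0) : E × E)) (by fun_prop)
      (fun p hp => ⟨hp.2, G.zero_mem_U⟩)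
  have h3 : ContDiffOn ℝ ∞ (fun p : E × E => ((0, p.1) : E × E)) (univ ×ˢ G.U) := by fun_prop
  exact (h2.clm_apply h3).congr fun p hp => G.leftInvariantField_eq hp.2 p.1

/-- `γ` is an integral curve on `[0, 1]` of the left-invariant vector field of `ξ`. -/
def IsLeftInvariantCurve (ξ : E) (γ : ℝ → E) : Prop :=
  ∀ t ∈ Icc (0 : ℝ) 1, γ t ∈ G.U ∧
    HasDerivWithinAt γ (G.leftInvariantField ξ (γ t)) (Icc 0 1) t

variable {G}

/-- The field is locally Lipschitz, hence Lipschitz on the compact union of the two images, and ODE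
uniqueness applies there. -/
theorem IsLeftInvariantCurve.eqOn [FiniteDimensional ℝ E] {ξ : E} {γ η : ℝ → E}
    (hγ : G.IsLeftInvariantCurve ξ γ) (hη : G.IsLeftInvariantCurve ξ η) (h0 : γ 0 = η 0) :
    EqOn γ η (Icc 0 1) := by
  have hγc : ContinuousOn γ (Icc 0 1) := fun t ht => (hγ t ht).2.continuousWithinAt
  have hηc : ContinuousOn η (Icc 0 1) := fun t ht => (hη t ht).2.continuousWithinAt
  set K := γ '' Icc 0 1 ∪ η '' Icc 0 1
  have hK : IsCompact K := (isCompact_Icc.image_of_continuousOn hγc).union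
    (isCompact_Icc.image_of_continuousOn hηc)
  have hKU : K ⊆ G.U := by
    rintro _ (⟨t, ht, rfl⟩ | ⟨t, ht, rfl⟩)
    exacts [(hγ t ht).1, (hη t ht).1]
  have hLip : LocallyLipschitzOn K (G.leftInvariantField ξ) := by
    intro g hg
    have h1 : ContDiffAt ℝ 1 (G.leftInvariantField ξ) g := by
      have h2 : ContDiffAt ℝ ∞ (fun p : E × E => G.leftInvariantField p.1 p.2) (ξ, g) :=
        G.contDiffOn_leftInvariantField.contDiffAt
          ((isOpen_univ.prod G.isOpen_U).mem_nhds ⟨mem_univ _, hKU hg⟩)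
      have h3 : ContDiffAt ℝ ∞ (G.leftInvariantField ξ) g :=
        ContDiffAt.comp g (f := fun g => (ξ, g)) h2 (by fun_prop)
      exact h3.of_le ENat.LEInfty.out
    obtain ⟨C, s, hs, hCs⟩ := h1.exists_lipschitzOnWith
    exact ⟨C, s, mem_nhdsWithin_of_mem_nhds hs, hCs⟩
  obtain ⟨C, hC⟩ := hLip.exists_lipschitzOnWith_of_compact hK
  refine ODE_solution_unique_of_mem_Icc_right (v := fun _ => G.leftInvariantField ξ)
    (s := fun _ => K) (K := C) (fun _ _ => hC) hγc (fun t ht => ?_) (fun t ht => ?_) hηc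
    (fun t ht => ?_) (fun t ht => ?_) h0
  · exact (hγ t (Ico_subset_Icc_self ht)).2.mono_of_mem_nhdsWithin (Icc_mem_nhdsGE_of_mem ht)
  · exact .inl ⟨t, Ico_subset_Icc_self ht, rfl⟩
  · exact (hη t (Ico_subset_Icc_self ht)).2.mono_of_mem_nhdsWithin (Icc_mem_nhdsGE_of_mem ht)
  · exact .inr ⟨t, Ico_subset_Icc_self ht, rfl⟩

theorem IsLeftInvariantCurve.exp_eq [FiniteDimensional ℝ E] {ξ : E} {γ : ℝ → E}
    (hγ : G.IsLeftInvariantCurve ξ γ) (h0 : γ 0 = 0) : G.exp ξ = γ 1 := by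
  have hex : ∃ g, G.IsExp ξ g := ⟨γ 1, γ, h0, rfl, hγ⟩
  rw [exp, dif_pos hex]
  obtain ⟨η, hη0, hη1, hη⟩ := hex.choose_spec
  rw [← hη1]
  exact IsLeftInvariantCurve.eqOn hη hγ (hη0.trans h0.symm) (by simp)

/-- Left translates of integral curves are integral curves. -/
theorem IsLeftInvariantCurve.mul_left {ξ g : E} {γ : ℝ → E} (hγ : G.IsLeftInvariantCurve ξ γ)
    (hg : g ∈ G.U) (hmem : ∀ t ∈ Icc (0 : ℝ) 1, G.mul g (γ t) ∈ G.U) :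
    G.IsLeftInvariantCurve ξ (fun t => G.mul g (γ t)) := by
  intro t ht
  refine ⟨hmem t ht, ?_⟩
  obtain ⟨hU, hd⟩ := hγ t ht
  have hmulU : ∀ᶠ y in 𝓝 (0 : E), G.mul (γ t) y ∈ G.U := by
    have hc := (G.hasFDerivAt_mul_left hU G.zero_mem_U).continuousAt
    refine hc.tendsto.eventually_mem (G.isOpen_U.mem_nhds ?_)
    rwa [G.mul_zero _ hU]
  have heq : (fun y => G.mul (G.mul g (γ t)) y) =ᶠ[𝓝 0] fun y => G.mul g (G.mul (γ t) y) := by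
    filter_upwards [hmulU, G.U_mem_nhds] with y h1 h2
    exact G.mul_assoc g hg _ hU y h2 (hmem t ht) h1
  have h1 := G.hasFDerivAt_mul_left hg hU
  have h2 := (G.hasFDerivAt_mul_left hU G.zero_mem_U)
  have h3 : HasFDerivAt (fun y => G.mul g (G.mul (γ t) y)) _ 0 :=
    h1.fun_comp_of_eq h2 (G.mul_zero _ hU)
  have h4 : G.leftInvariantField ξ (G.mul g (γ t)) =
      (fderiv ℝ G.mulPair (g, γ t)).comp (.inr ℝ E E) (G.leftInvariantField ξ (γ t)) := by
    rw [leftInvariantField, heq.fderiv_eq, h3.fderiv, ContinuousLinearMap.comp_apply,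
      leftInvariantField, h2.fderiv]
  rw [h4]
  exact h1.comp_hasDerivWithinAt t hd

/-- Half of an integral curve, reparametrised. -/
theorem IsLeftInvariantCurve.comp_half {ξ : E} {γ : ℝ → E}
    (hγ : G.IsLeftInvariantCurve ((2 : ℝ) • ξ) γ) {c : ℝ} (hc0 : 0 ≤ c) (hc1 : c ≤ 1 / 2) :
    G.IsLeftInvariantCurve ξ (fun t => γ (c + t / 2)) := by
  intro t ht
  have hmaps : MapsTo (fun t : ℝ => c + t / 2) (Icc 0 1) (Icc 0 1) := fun s hs =>
    ⟨by have := hs.1; positivity, by have := hs.2; linarith⟩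
  obtain ⟨hU, hd⟩ := hγ _ (hmaps ht)
  refine ⟨hU, ?_⟩
  have h1 : HasDerivWithinAt (fun t : ℝ => c + t / 2) (1 / 2) (Icc 0 1) t :=
    (((hasDerivAt_id t).div_const 2).const_add c).hasDerivWithinAt
  have h2 := HasDerivWithinAt.scomp t hd h1 hmaps
  rw [G.leftInvariantField_smul, smul_smul] at h2
  simpa [Function.comp_def] using h2

variable (G)

/-- By uniqueness of integral curves, the chosen value `exp` agrees near 0 with the smooth time-one
flow. The confinement to W keeps later products inside the domain of the group law. -/
theorem eventually_exists_curve [FiniteDimensional ℝ E] :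
    ContDiffAt ℝ ∞ G.exp 0 ∧ G.exp 0 = 0 ∧ HasFDerivAt G.exp (.id ℝ E) 0 ∧
      ∀ W ∈ 𝓝 (0 : E), ∀ᶠ ξ in 𝓝 (0 : E), ∃ γ : ℝ → E, γ 0 = 0 ∧ γ 1 = G.exp ξ ∧
        (∀ t ∈ Icc (0 : ℝ) 1, γ t ∈ W) ∧ G.IsLeftInvariantCurve ξ γ := by
  obtain ⟨e, he, he0, hde, hcurve⟩ := exists_contDiffAt_flow
    (X := fun p : E × E => G.leftInvariantField p.1 p.2)
    ((isOpen_univ.prod G.isOpen_U).mem_nhds ⟨mem_univ _, G.zero_mem_U⟩)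
    G.contDiffOn_leftInvariantField (.of_forall fun g => G.leftInvariantField_zero g)
    G.leftInvariantField_apply_zero
  have heq : G.exp =ᶠ[𝓝 0] e := by
    filter_upwards [hcurve _ G.U_mem_nhds] with ξ ⟨γ, h0, h1, hγ⟩
    rw [← h1]
    exact IsLeftInvariantCurve.exp_eq (G := G) hγ h0
  refine ⟨he.congr_of_eventuallyEq heq, heq.self_of_nhds.trans he0,
    hde.congr_of_eventuallyEq heq, fun W hW => ?_⟩
  filter_upwards [hcurve _ (inter_mem hW G.U_mem_nhds), heq] with ξ ⟨γ, h0, h1, hγ⟩ hξ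
  exact ⟨γ, h0, h1.trans hξ.symm, fun t ht => (hγ t ht).1.1,
    fun t ht => ⟨(hγ t ht).1.2, (hγ t ht).2⟩⟩

theorem tendsto_mulPair : Tendsto G.mulPair (𝓝 0) (𝓝 0) := by
  simpa [G.isUnitalGerm_mulPair.map_zero] using
    G.isUnitalGerm_mulPair.contDiffAt.continuousAt.tendsto

theorem bracket_eq_mulPair (ξ η : E) :
    G.bracket ξ η = mixedXY G.mulPair ξ η - mixedXY G.mulPair η ξ := by
  have h (ξ η : E) : fderiv ℝ (G.leftInvariantField η) 0 ξ = mixedXY G.mulPair ξ η := by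
    have h1 : G.leftInvariantField η =ᶠ[𝓝 0] fun g => fderiv ℝ G.mulPair (g, 0) (0, η) := by
      filter_upwards [G.U_mem_nhds] with g hg using G.leftInvariantField_eq hg η
    have h2 : HasFDerivAt (fun g : E => fderiv ℝ G.mulPair (g, 0)) _ 0 :=
      HasFDerivAt.comp (0 : E) (f := fun g : E => ((g, 0) : E × E))
        G.isUnitalGerm_mulPair.contDiffAt.fderiv_infty.differentiableAt_infty.hasFDerivAt
        (ContinuousLinearMap.inl ℝ E E).hasFDerivAt
    rw [h1.fderiv_eq, (h2.clm_apply (hasFDerivAt_const ((0, η) : E × E) 0)).fderiv]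
    simp
    rfl
  rw [bracket, VectorField.lieBracket, G.leftInvariantField_apply_zero,
    G.leftInvariantField_apply_zero, h, h]

variable [FiniteDimensional ℝ E]

theorem contDiffAt_exp : ContDiffAt ℝ ∞ G.exp 0 := G.eventually_exists_curve.1

theorem exp_zero : G.exp 0 = 0 := G.eventually_exists_curve.2.1

theorem hasFDerivAt_exp : HasFDerivAt G.exp (.id ℝ E) 0 := G.eventually_exists_curve.2.2.1

theorem tendsto_exp : Tendsto G.exp (𝓝 0) (𝓝 0) := by
  simpa [G.exp_zero] using G.contDiffAt_exp.continuousAt.tendsto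

/-- The second half of the curve of 2ξ, reparametrised, and the left translate by exp ξ of the curve
of ξ are integral curves of the same field from the same point exp ξ; compare their endpoints. -/
theorem exp_mul_exp_self :
    ∀ᶠ ξ in 𝓝 (0 : E), G.mul (G.exp ξ) (G.exp ξ) = G.exp ((2 : ℝ) • ξ) := by
  obtain ⟨W, hW, hWU⟩ : ∃ W ∈ 𝓝 (0 : E), ∀ g ∈ W, ∀ h ∈ W, G.mul g h ∈ G.U := by
    have h := G.tendsto_mulPair.eventually_mem G.U_mem_nhds
    rw [show (0 : E × E) = (0, 0) from rfl, nhds_prod_eq] at h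
    obtain ⟨W, hW, h⟩ := (eventually_prod_self_iff (r := fun g h => G.mul g h ∈ G.U)).1 h
    exact ⟨W, hW, fun g hg k hk => h g hg k hk⟩
  have h := G.eventually_exists_curve.2.2.2 W hW
  have h2 : Tendsto (fun ξ : E => (2 : ℝ) • ξ) (𝓝 0) (𝓝 0) := by
    simpa using (continuous_const_smul (2 : ℝ)).tendsto (0 : E)
  filter_upwards [h, h2.eventually h, G.tendsto_exp.eventually_mem (inter_mem hW G.U_mem_nhds)]
    with ξ ⟨γ, hγ0, hγ1, hγW, hγ⟩ ⟨η, hη0, hη1, hηW, hη⟩ hξ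
  have hhalf : η (1 / 2) = G.exp ξ := by
    have := IsLeftInvariantCurve.exp_eq (hη.comp_half le_rfl (by norm_num)) (by simpa using hη0)
    rw [this]; norm_num
  have hβ := hγ.mul_left hξ.2 (fun t ht => hWU _ hξ.1 _ (hγW t ht))
  have hα := hη.comp_half (c := 1 / 2) (by norm_num) le_rfl
  have := hβ.eqOn hα (by simp only [hγ0, G.mul_zero _ hξ.2]; simp [← hhalf])
    (right_mem_Icc.2 zero_le_one)
  simp only [hγ1] at this
  rw [this, ← hη1]
  norm_num

/-- A logarithm: a germ of a smooth local inverse of the exponential map. -/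
theorem exists_log : ∃ log : E → E, ContDiffAt ℝ ∞ log 0 ∧ log 0 = 0 ∧
    (∀ᶠ x in 𝓝 0, log (G.exp x) = x) ∧ ∀ᶠ g in 𝓝 0, G.exp (log g) = g := by
  have : CompleteSpace E := FiniteDimensional.complete ℝ E
  obtain ⟨log, h1, h2, -, h3⟩ :=
    G.contDiffAt_exp.exists_local_inverse G.exp_zero (e := .refl ℝ E) G.hasFDerivAt_exp
  exact ⟨log, h1, h2, h3⟩

/-- A chosen logarithm, the inverse of the exponential map near `0`. -/
def log : E → E := G.exists_log.choose

/-- The group law in logarithmic coordinates. -/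
def bch (p : E × E) : E := G.log (G.mulPair (G.exp p.1, G.exp p.2))

theorem contDiffAt_log : ContDiffAt ℝ ∞ G.log 0 := G.exists_log.choose_spec.1

theorem log_zero : G.log 0 = 0 := G.exists_log.choose_spec.2.1

theorem log_exp : ∀ᶠ x in 𝓝 0, G.log (G.exp x) = x := G.exists_log.choose_spec.2.2.1

theorem exp_log : ∀ᶠ g in 𝓝 0, G.exp (G.log g) = g := G.exists_log.choose_spec.2.2.2

theorem tendsto_log : Tendsto G.log (𝓝 0) (𝓝 0) := by
  simpa [G.log_zero] using G.contDiffAt_log.continuousAt.tendsto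

theorem bch_apply (x y : E) : G.bch (x, y) = G.log (G.mul (G.exp x) (G.exp y)) := rfl

theorem tendsto_exp_prod :
    Tendsto (fun p : E × E => (G.exp p.1, G.exp p.2)) (𝓝 0) (𝓝 0) :=
  (G.tendsto_exp.comp (continuous_fst.tendsto (0 : E × E))).prodMk_nhds
    (G.tendsto_exp.comp (continuous_snd.tendsto (0 : E × E)))

theorem exp_bch : ∀ᶠ p : E × E in 𝓝 0, G.exp (G.bch p) = G.mul (G.exp p.1) (G.exp p.2) :=
  (G.tendsto_mulPair.comp G.tendsto_exp_prod).eventually G.exp_log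

theorem isNormalGroupGerm_bch : IsNormalGroupGerm G.bch where
  contDiffAt := by
    have h1 : ContDiffAt ℝ ∞ (fun p : E × E => (G.exp p.1, G.exp p.2)) 0 :=
      (ContDiffAt.comp (0 : E × E) (f := Prod.fst) G.contDiffAt_exp contDiffAt_fst).prodMk
        (ContDiffAt.comp (0 : E × E) (f := Prod.snd) G.contDiffAt_exp contDiffAt_snd)
    have h2 : ContDiffAt ℝ ∞ (fun p : E × E => G.mulPair (G.exp p.1, G.exp p.2)) 0 :=
      G.isUnitalGerm_mulPair.contDiffAt.fun_comp_of_eq h1 (by simp [G.exp_zero])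
    refine G.contDiffAt_log.fun_comp_of_eq h2 ?_
    simpa [G.exp_zero] using! G.isUnitalGerm_mulPair.map_zero
  right_unit := by
    filter_upwards [G.log_exp, G.tendsto_exp.eventually_mem G.U_mem_nhds] with x h1 h2
    rw [bch_apply, G.exp_zero, G.mul_zero _ h2, h1]
  left_unit := by
    filter_upwards [G.log_exp, G.tendsto_exp.eventually_mem G.U_mem_nhds] with x h1 h2
    rw [bch_apply, G.exp_zero, G.zero_mul _ h2, h1]
  assoc := by
    have hx : Tendsto (fun p : E × E × E => G.exp p.1) (𝓝 0) (𝓝 0) :=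
      G.tendsto_exp.comp (continuous_fst.tendsto (0 : E × E × E))
    have hy : Tendsto (fun p : E × E × E => G.exp p.2.1) (𝓝 0) (𝓝 0) :=
      G.tendsto_exp.comp ((continuous_fst.comp continuous_snd).tendsto (0 : E × E × E))
    have hz : Tendsto (fun p : E × E × E => G.exp p.2.2) (𝓝 0) (𝓝 0) :=
      G.tendsto_exp.comp ((continuous_snd.comp continuous_snd).tendsto (0 : E × E × E))
    have hxy : Tendsto (fun p : E × E × E => (p.1, p.2.1)) (𝓝 0) (𝓝 0) :=
      (by fun_prop : Continuous (fun p : E × E × E => (p.1, p.2.1))).tendsto 0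
    have hyz : Tendsto (fun p : E × E × E => p.2) (𝓝 0) (𝓝 0) := continuous_snd.tendsto 0
    filter_upwards [hxy.eventually G.exp_bch, hyz.eventually G.exp_bch,
      hx.eventually_mem G.U_mem_nhds, hy.eventually_mem G.U_mem_nhds,
      hz.eventually_mem G.U_mem_nhds,
      (G.tendsto_mulPair.comp (hx.prodMk_nhds hy)).eventually_mem G.U_mem_nhds,
      (G.tendsto_mulPair.comp (hy.prodMk_nhds hz)).eventually_mem G.U_mem_nhds]
      with p h1 h2 h3 h4 h5 h6 h7
    rw [bch_apply (x := G.bch _), bch_apply (y := G.bch _), h1, h2, G.mul_assoc _ h3 _ h4 _ h5 h6 h7]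
  double := by
    have h2 : Tendsto (fun ξ : E => (2 : ℝ) • ξ) (𝓝 0) (𝓝 0) := by
      simpa using (continuous_const_smul (2 : ℝ)).tendsto (0 : E)
    filter_upwards [G.exp_mul_exp_self, h2.eventually G.log_exp] with x h1 h3
    rw [bch_apply, h1, h3]

/-- Passing to logarithmic coordinates changes the mixed derivative only by D²exp(0), which is
symmetric and drops out of the bracket. -/
theorem bracket_eq_bch (ξ η : E) : G.bracket ξ η = (2 : ℝ) • mixedXY G.bch ξ η := by
  have hm := G.isNormalGroupGerm_bch
  have hE := G.hasFDerivAt_exp.fderiv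
  have key (ξ η : E) : mixedXY G.mulPair ξ η =
      mixedXY G.bch ξ η + fderiv ℝ (fderiv ℝ G.exp) 0 ξ η := by
    have hx := HasCubicJet.line ξ
    have hy := HasCubicJet.line η
    have h1 := (hm.hasCubicJet hx hy).comp_contDiffAt G.contDiffAt_exp G.exp_zero
    have h2 := G.isUnitalGerm_mulPair.hasCubicJet (hx.comp_contDiffAt G.contDiffAt_exp G.exp_zero)
      (hy.comp_contDiffAt G.contDiffAt_exp G.exp_zero)
    have hev : ∀ᶠ t in 𝓝 (0 : ℝ), G.exp (G.bch (t • ξ, t • η)) =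
        G.mulPair (G.exp (t • ξ), G.exp (t • η)) := by
      have := (HasCubicJet.line ((ξ, η) : E × E)).tendsto_zero.eventually G.exp_bch
      simpa using! this
    have h := ((h1.congr' hev).coeff_unique h2).2.1
    simp only [hE, ContinuousLinearMap.id_apply, map_add, add_apply,
      G.contDiffAt_exp.fderiv_fderiv_symm η ξ] at h
    linear_combination (norm := module) -h
  rw [G.bracket_eq_mulPair, key, key, G.contDiffAt_exp.fderiv_fderiv_symm η ξ,
    hm.mixedXY_antisymm η ξ]
  module

end LocalLieGroup

/-! ### Local form of the subgroup and of the section -/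

namespace LocalLieGroup

variable {E : Type*} [NormedAddCommGroup E] [NormedSpace ℝ E]

/-- `πV` and `πh` are the projections of a direct sum decomposition `E = V ⊕ 𝔥`. -/
structure IsSplitting {V 𝔥 : Submodule ℝ E} (πV : E →L[ℝ] V) (πh : E →L[ℝ] 𝔥) : Prop where
  sum : ∀ x, (πV x : E) + (πh x : E) = x
  apply_right : ∀ k : 𝔥, πV k = 0
  apply_left : ∀ x : V, πh x = 0

namespace IsSplitting

variable {V 𝔥 : Submodule ℝ E} {πV : E →L[ℝ] V} {πh : E →L[ℝ] 𝔥}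

theorem left_left (h : IsSplitting πV πh) (x : V) : πV x = x := by
  have := h.sum x
  rw [h.apply_left] at this
  exact Subtype.ext (by simpa using this)

theorem right_right (h : IsSplitting πV πh) (k : 𝔥) : πh k = k := by
  have := h.sum k
  rw [h.apply_right] at this
  exact Subtype.ext (by simpa using this)

theorem left_add (h : IsSplitting πV πh) (x : V) (k : 𝔥) : πV ((x : E) + k) = x := by
  rw [map_add, h.left_left, h.apply_right, add_zero]

theorem right_add (h : IsSplitting πV πh) (x : V) (k : 𝔥) : πh ((x : E) + k) = k := by
  rw [map_add, h.apply_left, h.right_right, zero_add]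

theorem mem_left_iff (h : IsSplitting πV πh) (x : E) : x ∈ V ↔ πh x = 0 := by
  refine ⟨fun hx => h.apply_left ⟨x, hx⟩, fun hx => ?_⟩
  rw [← h.sum x, hx]
  simp

end IsSplitting

variable [FiniteDimensional ℝ E] (G : LocalLieGroup E)

theorem exists_defining_map {S : Set E} {T : Submodule ℝ E} (hS : IsSubmanifoldAtZero S T) :
    ∃ Θ : E → E, ContDiffAt ℝ ∞ Θ 0 ∧ Θ 0 = 0 ∧ HasFDerivAt Θ (.id ℝ E) 0 ∧
      ∀ᶠ η in 𝓝 (0 : E), G.exp η ∈ S ↔ Θ η ∈ T := by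
  obtain ⟨Φ, h0, hΦ0, hΦ, -, hD, hmem⟩ := hS
  have hsrc : Φ.source ∈ 𝓝 (0 : E) := Φ.open_source.mem_nhds h0
  refine ⟨fun η => Φ (G.exp η), ?_, ?_, ?_, ?_⟩
  · exact (hΦ.contDiffAt hsrc).fun_comp_of_eq G.contDiffAt_exp G.exp_zero
  · simp [G.exp_zero, hΦ0]
  · exact hD.fun_comp_of_eq G.hasFDerivAt_exp G.exp_zero
  · filter_upwards [G.tendsto_exp.eventually_mem hsrc] with η hη using hmem _ hη

theorem tendsto_zero_of_contDiffAt {X Y : Type*} [NormedAddCommGroup X] [NormedSpace ℝ X]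
    [NormedAddCommGroup Y] [NormedSpace ℝ Y] {f : X → Y} (hf : ContDiffAt ℝ ∞ f 0)
    (h0 : f 0 = 0) : Tendsto f (𝓝 0) (𝓝 0) := by
  simpa [h0] using hf.continuousAt.tendsto

/-- A locally closed set which is stable under doubling and has tangent space `𝔥` at `0` contains
a neighbourhood of `0` in `𝔥`. -/
theorem eventually_mem_of_double {𝔥 : Submodule ℝ E} {Θ : E → E} (hΘ : ContDiffAt ℝ ∞ Θ 0)
    (hΘ0 : Θ 0 = 0) (hΘD : HasFDerivAt Θ (.id ℝ E) 0)
    (hdouble : ∀ᶠ η in 𝓝 (0 : E), Θ η ∈ 𝔥 → Θ ((2 : ℝ) • η) ∈ 𝔥) :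
    ∀ᶠ k in 𝓝 (0 : E), k ∈ 𝔥 → Θ k ∈ 𝔥 := by
  have : CompleteSpace E := FiniteDimensional.complete ℝ E
  obtain ⟨σ, hσ, hσ0, hσD, -, hright⟩ := hΘ.exists_local_inverse hΘ0 (e := .refl ℝ E) hΘD
  -- The factor 2 guarantees that all doublings below stay within 2‖k‖ < r, whence the radius r / 2
  -- for k.
  have hbound : ∀ᶠ y in 𝓝 (0 : E), ‖σ y‖ ≤ 2 * ‖y‖ := by
    have h := hσD.isLittleO
    simp only [sub_zero, hσ0] at h
    filter_upwards [h.def one_pos] with y hy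
    have hy' : ‖σ y - y‖ ≤ 1 * ‖y‖ := hy
    calc ‖σ y‖ = ‖(σ y - y) + y‖ := by simp
      _ ≤ ‖σ y - y‖ + ‖y‖ := norm_add_le _ _
      _ ≤ 2 * ‖y‖ := by linarith
  have hcont : ∀ᶠ η in 𝓝 (0 : E), ContinuousAt Θ η := by
    filter_upwards [hΘ.eventually_differentiableAt] with η h using h.continuousAt
  obtain ⟨r, hr, hball⟩ := Metric.eventually_nhds_iff_ball.1
    (hdouble.and (hbound.and (hright.and hcont)))
  filter_upwards [Metric.ball_mem_nhds (0 : E) (half_pos hr)] with k hk hk𝔥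
  have hk' : ‖k‖ < r / 2 := by simpa using hk
  have hsmall (n : ℕ) : ‖((2 : ℝ) ^ n)⁻¹ • k‖ ≤ ‖k‖ := by
    rw [norm_smul, norm_inv, norm_pow, Real.norm_two]
    exact mul_le_of_le_one_left (norm_nonneg _) (inv_le_one_of_one_le₀ (one_le_pow₀ one_le_two))
  have hin (n : ℕ) : ((2 : ℝ) ^ n)⁻¹ • k ∈ Metric.ball (0 : E) r := by
    rw [mem_ball_zero_iff]
    linarith [hsmall n]
  -- The point σ(2⁻ⁿk) lies in the set because Θ sends it to 2⁻ⁿk ∈ 𝔥. Doubling it n times stays in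
  -- the set, and the results tend to k since Dσ(0) = id; closedness of 𝔥 concludes.
  have hiter (n j : ℕ) (hj : j ≤ n) : Θ ((2 : ℝ) ^ j • σ (((2 : ℝ) ^ n)⁻¹ • k)) ∈ 𝔥 := by
    induction j with
    | zero =>
      rw [pow_zero, one_smul, (hball _ (hin n)).2.2.1]
      exact 𝔥.smul_mem _ hk𝔥
    | succ j ih =>
      rw [pow_succ', mul_smul]
      refine (hball _ ?_).1 (ih (by lia))
      rw [mem_ball_zero_iff, norm_smul, norm_pow, Real.norm_two]
      have h1 := (hball _ (hin n)).2.1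
      rw [norm_smul, norm_inv, norm_pow, Real.norm_two] at h1
      have h2 : (2 : ℝ) ^ j ≤ 2 ^ n := pow_le_pow_right₀ one_le_two (by lia)
      calc (2 : ℝ) ^ j * ‖σ (((2 : ℝ) ^ n)⁻¹ • k)‖
          ≤ 2 ^ n * (2 * ((2 ^ n)⁻¹ * ‖k‖)) := by gcongr
        _ = 2 * ‖k‖ := by field_simp
        _ < r := by linarith
  have hlim : Tendsto (fun n : ℕ => (2 : ℝ) ^ n • σ (((2 : ℝ) ^ n)⁻¹ • k)) atTop (𝓝 k) := by
    have h := hσD.lim k (c := fun n : ℕ => (2 : ℝ) ^ n) (l := atTop)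
      (by simpa using tendsto_pow_atTop_atTop_of_one_lt (one_lt_two (α := ℝ)))
    simpa [hσ0] using h
  have hk0 : ContinuousAt Θ k := (hball k (by simpa using hk'.trans (half_lt_self hr))).2.2.2
  exact 𝔥.closed_of_finiteDimensional.mem_of_tendsto (hk0.tendsto.comp hlim)
    (.of_forall fun n => hiter n n le_rfl)

/-- Near the unit, a local Lie subgroup is the image of its Lie algebra by the exponential map. -/
theorem IsLocalLieSubgroup.exp_mem_iff {G : LocalLieGroup E} {H : Set E} {V 𝔥 : Submodule ℝ E}
    (hH : G.IsLocalLieSubgroup H 𝔥) {πV : E →L[ℝ] V} {πh : E →L[ℝ] 𝔥}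
    (hπ : IsSplitting πV πh) : ∀ᶠ η in 𝓝 (0 : E), G.exp η ∈ H ↔ η ∈ 𝔥 := by
  have : CompleteSpace E := FiniteDimensional.complete ℝ E
  obtain ⟨Θ, hΘ, hΘ0, hΘD, hΘH⟩ := G.exists_defining_map hH.isSubmanifold
  obtain ⟨W, hW, hmul⟩ := hH.mul_mem
  have h2 : Tendsto (fun ξ : E => (2 : ℝ) • ξ) (𝓝 0) (𝓝 0) := by
    simpa using (continuous_const_smul (2 : ℝ)).tendsto (0 : E)
  have hsub : ∀ᶠ k in 𝓝 (0 : E), k ∈ 𝔥 → Θ k ∈ 𝔥 := by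
    refine eventually_mem_of_double hΘ hΘ0 hΘD ?_
    filter_upwards [hΘH, h2.eventually hΘH, G.exp_mul_exp_self, G.tendsto_exp.eventually_mem hW]
      with η h1 h3 h4 h5 h6
    have h7 := h1.2 h6
    rw [← h3, ← h4]
    exact hmul _ ⟨h7, h5⟩ _ ⟨h7, h5⟩
  obtain ⟨σ, -, -, -, hleft, -⟩ := hΘ.exists_local_inverse hΘ0 (e := .refl ℝ E) hΘD
  -- For the converse: near 0, Θ maps 𝔥 into itself, so θ is its restriction and a local
  -- diffeomorphism of 𝔥. If Θ η ∈ 𝔥, some k ∈ 𝔥 has Θ k = Θ η, and local injectivity of Θ gives η =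
  -- k.
  let θ : 𝔥 → 𝔥 := fun k => πh (Θ k)
  have hθ : ContDiffAt ℝ ∞ θ 0 := πh.contDiff.contDiffAt.fun_comp_of_eq
    (hΘ.fun_comp_of_eq 𝔥.subtypeL.contDiff.contDiffAt rfl) rfl
  have hθ0 : θ 0 = 0 := by simp [θ, hΘ0]
  have hθD : HasFDerivAt θ ((ContinuousLinearEquiv.refl ℝ 𝔥 : 𝔥 ≃L[ℝ] 𝔥) : 𝔥 →L[ℝ] 𝔥) 0 := by
    have h := πh.hasFDerivAt.fun_comp_of_eq
      (hΘD.fun_comp_of_eq (𝔥.subtypeL.hasFDerivAt (x := (0 : 𝔥))) rfl) rfl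
    refine h.congr_fderiv (ContinuousLinearMap.ext fun k => ?_)
    exact hπ.right_right k
  obtain ⟨τ, hτ, hτ0, -, -, hτr⟩ := hθ.exists_local_inverse hθ0 hθD
  have ht1 : Tendsto (fun η => πh (Θ η)) (𝓝 0) (𝓝 0) := by
    simpa [Function.comp_def] using (πh.continuous.tendsto 0).comp
      (tendsto_zero_of_contDiffAt hΘ hΘ0)
  have ht2 : Tendsto (fun η => ((τ (πh (Θ η)) : 𝔥) : E)) (𝓝 0) (𝓝 0) := by
    have := (𝔥.subtypeL.continuous.tendsto 0).comp ((tendsto_zero_of_contDiffAt hτ hτ0).comp ht1)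
    simpa using! this
  filter_upwards [hΘH, hsub, hleft, ht1.eventually hτr, ht2.eventually hleft, ht2.eventually hsub]
    with η h1 h3 h4 h5 h6 h7
  rw [h1]
  refine ⟨fun h => ?_, h3⟩
  have h8 := h7 (SetLike.coe_mem _)
  have h9 : Θ (τ (πh (Θ η)) : 𝔥) = Θ η := by
    have e1 := hπ.right_right ⟨_, h8⟩
    have e2 := hπ.right_right ⟨_, h⟩
    simp only at e1 e2
    have e3 : πh (Θ (τ (πh (Θ η)) : 𝔥)) = πh (Θ η) := h5
    rw [e1] at e3
    have e4 := e3.trans e2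
    exact congrArg Subtype.val e4
  rw [← h4, ← h9, h6]
  exact SetLike.coe_mem _

variable {V 𝔥 : Submodule ℝ E} {πV : E →L[ℝ] V} {πh : E →L[ℝ] 𝔥}

/-- Existence, uniqueness and smoothness of the germ of a section map. -/
theorem exists_isSectionMap (hπ : IsSplitting πV πh) {Q : Set E} (hQ : IsSubmanifoldAtZero Q V) :
    ∃ φ : V → 𝔥, G.IsSectionMap Q φ ∧ ContDiffAt ℝ ∞ φ 0 ∧ fderiv ℝ φ 0 = 0 ∧
      ∀ ψ : V → 𝔥, G.IsSectionMap Q ψ → ψ =ᶠ[𝓝 0] φ := by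
  have : CompleteSpace E := FiniteDimensional.complete ℝ E
  obtain ⟨Θ, hΘ, hΘ0, hΘD, hΘQ⟩ := G.exists_defining_map hQ
  -- A keeps the V-component and straightens Q: near 0, exp η ∈ Q iff A η ∈ V. Hence Q is a graph
  -- over V in logarithmic coordinates, and φ is the 𝔥-component of A⁻¹ on V.
  let A : E → E := fun η => V.subtypeL (πV η) + 𝔥.subtypeL (πh (Θ η))
  have hA : ContDiffAt ℝ ∞ A 0 :=
    (V.subtypeL.comp πV).contDiff.contDiffAt.add
      ((𝔥.subtypeL.comp πh).contDiff.contDiffAt.comp _ hΘ)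
  have hA0 : A 0 = 0 := by simp [A, hΘ0]
  have hAD : HasFDerivAt A ((ContinuousLinearEquiv.refl ℝ E : E ≃L[ℝ] E) : E →L[ℝ] E) 0 := by
    have h := ((V.subtypeL.comp πV).hasFDerivAt (x := (0 : E))).add
      ((𝔥.subtypeL.comp πh).hasFDerivAt.fun_comp_of_eq hΘD rfl)
    refine h.congr_fderiv (ContinuousLinearMap.ext fun x => ?_)
    exact hπ.sum x
  obtain ⟨B, hB, hB0, hBD, hleft, hright⟩ := hA.exists_local_inverse hA0 hAD
  have hAV (η : E) : πV (A η) = πV η := hπ.left_add _ _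
  have hAh (η : E) : πh (A η) = πh (Θ η) := hπ.right_add _ _
  let φ : V → 𝔥 := fun ξ => πh (B ξ)
  have hφ : ContDiffAt ℝ ∞ φ 0 := πh.contDiff.contDiffAt.fun_comp_of_eq
    (hB.fun_comp_of_eq V.subtypeL.contDiff.contDiffAt rfl) rfl
  have hφ0 : φ 0 = 0 := by simp [φ, hB0]
  have hφD : fderiv ℝ φ 0 = 0 := by
    have h : HasFDerivAt φ _ 0 := πh.hasFDerivAt.fun_comp_of_eq
      (hBD.fun_comp_of_eq (V.subtypeL.hasFDerivAt (x := (0 : V))) rfl) rfl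
    rw [h.fderiv]
    exact ContinuousLinearMap.ext fun x => hπ.apply_left x
  have hV0 : Tendsto (fun ξ : V => (ξ : E)) (𝓝 0) (𝓝 0) := V.subtypeL.continuous.tendsto 0
  have hBt : Tendsto (fun ξ : V => B ξ) (𝓝 0) (𝓝 0) :=
    (tendsto_zero_of_contDiffAt hB hB0).comp hV0
  refine ⟨φ, ⟨hφ0, hφ.continuousAt, ?_⟩, hφ, hφD, fun ψ hψ => ?_⟩
  · filter_upwards [hV0.eventually hright, hBt.eventually hΘQ] with ξ h1 h2
    have h3 : (ξ : E) + (φ ξ : E) = B ξ := by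
      have : πV (B ξ) = ξ := by rw [← hAV, h1, hπ.left_left]
      conv_rhs => rw [← hπ.sum (B ξ), this]
    rw [point, h3, h2, hπ.mem_left_iff, ← hAh, h1, hπ.apply_left]
  · have ht : Tendsto (fun ξ : V => (ξ : E) + (ψ ξ : E)) (𝓝 0) (𝓝 0) := by
      have h1 : Tendsto (fun ξ => ((ψ ξ : 𝔥) : E)) (𝓝 0) (𝓝 0) := by
        have := (𝔥.subtypeL.continuous.tendsto _).comp hψ.continuousAt.tendsto
        simpa [hψ.map_zero] using! this
      simpa using hV0.add h1
    filter_upwards [hψ.mem, ht.eventually hleft, ht.eventually hΘQ] with ξ h1 h2 h3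
    rw [point, h3, hπ.mem_left_iff, ← hAh] at h1
    have h4 : A ((ξ : E) + ψ ξ) = ξ := by
      conv_lhs => rw [← hπ.sum (A _)]
      rw [h1, hAV, hπ.left_add]
      simp
    rw [h4] at h2
    show ψ ξ = πh (B ξ)
    rw [h2, hπ.right_add]

end LocalLieGroup

/-! ### The germ of the loop law -/

namespace LocalLieGroup

variable {E : Type*} [NormedAddCommGroup E] [NormedSpace ℝ E]
  (G : LocalLieGroup E) {V 𝔥 : Submodule ℝ E} {πV : E →L[ℝ] V} {πh : E →L[ℝ] 𝔥}

theorem inv_zero : G.inv 0 = 0 := by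
  rw [← G.mul_zero _ (G.inv_mem 0 G.zero_mem_U₀)]
  exact G.inv_mul 0 G.zero_mem_U₀

theorem tendsto_inv : Tendsto G.inv (𝓝 0) (𝓝 0) := by
  have h := (G.contDiffOn_inv.contDiffAt
    (G.isOpen_U₀.mem_nhds G.zero_mem_U₀)).continuousAt.tendsto
  rwa [G.inv_zero] at h

/-- Left cancellation: `q h = g` gives `h = q⁻¹ g`. -/
theorem eq_inv_mul {q g h : E} (hq : q ∈ G.U₀) (hh : h ∈ G.U) (hg : g ∈ G.U)
    (heq : g = G.mul q h) : h = G.mul (G.inv q) g := by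
  have h1 := G.mul_assoc (G.inv q) (G.inv_mem q hq) q (G.U₀_subset hq) h hh
    (by rw [G.inv_mul q hq]; exact G.zero_mem_U) (heq ▸ hg)
  rw [G.inv_mul q hq, G.zero_mul h hh, ← heq] at h1
  exact h1

variable [FiniteDimensional ℝ E]

/-- Existence, uniqueness and smoothness of the germ of the loop law, with the equation relating
it to the group law in logarithmic coordinates. -/
theorem exists_isLoopLaw (hπ : IsSplitting πV πh) {H Q : Set E} (hH : G.IsLocalLieSubgroup H 𝔥)
    {φ : V → 𝔥} (hφQ : G.IsSectionMap Q φ) (hφ : ContDiffAt ℝ ∞ φ 0) (hφD : fderiv ℝ φ 0 = 0) :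
    ∃ (μ : V × V → V) (k : V × V → 𝔥), G.IsLoopLaw H Q φ μ ∧ IsUnitalGerm μ ∧
      ContDiffAt ℝ ∞ k 0 ∧ k 0 = 0 ∧
      (∀ᶠ p in 𝓝 (0 : V × V), G.bch ((p.1 : E) + φ p.1, (p.2 : E) + φ p.2) =
        G.bch ((μ p : E) + φ (μ p), k p)) ∧
      ∀ ν : V × V → V, G.IsLoopLaw H Q φ ν → ν =ᶠ[𝓝 0] μ := by
  have : CompleteSpace E := FiniteDimensional.complete ℝ E
  have hφ0 := hφQ.map_zero
  have hm := G.isNormalGroupGerm_bch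
  have hexpH := hH.exp_mem_iff hπ
  let s : V → E := fun x => V.subtypeL x + 𝔥.subtypeL (φ x)
  have hs : ContDiffAt ℝ ∞ s 0 := V.subtypeL.contDiff.contDiffAt.add
    (𝔥.subtypeL.contDiff.contDiffAt.fun_comp_of_eq hφ rfl)
  have hs0 : s 0 = 0 := by simp [s, hφ0]
  have hst := tendsto_zero_of_contDiffAt hs hs0
  have hsD : HasFDerivAt s V.subtypeL 0 := by
    have h1 := hφ.differentiableAt_infty.hasFDerivAt
    rw [hφD] at h1
    have h2 := (V.subtypeL.hasFDerivAt (x := (0 : V))).add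
      (𝔥.subtypeL.hasFDerivAt.fun_comp_of_eq h1 rfl)
    exact h2.congr_fderiv (by simp)
  have hpoint (x : V) : G.point φ x = G.exp (s x) := rfl
  -- The map (x, h) ↦ s(x)·h in logarithmic coordinates has derivative the identity at 0. Its
  -- inverse B factors a group element as section point times subgroup element, and μ, k are the two
  -- components of B applied to the product.
  let A : E → E := fun η => G.bch (s (πV η), 𝔥.subtypeL (πh η))
  have hin : ContDiffAt ℝ ∞ (fun η => (s (πV η), 𝔥.subtypeL (πh η))) 0 :=
    (hs.fun_comp_of_eq πV.contDiff.contDiffAt (map_zero _)).prodMk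
      (𝔥.subtypeL.comp πh).contDiff.contDiffAt
  have hin0 : (s (πV 0), 𝔥.subtypeL (πh 0)) = 0 := by simp [hs0]
  have hA : ContDiffAt ℝ ∞ A 0 := hm.contDiffAt.fun_comp_of_eq hin hin0
  have hA0 : A 0 = 0 := by simp only [A]; rw [hin0]; exact hm.map_zero
  have hAD : HasFDerivAt A ((ContinuousLinearEquiv.refl ℝ E : E ≃L[ℝ] E) : E →L[ℝ] E) 0 := by
    have h1 := (hsD.fun_comp_of_eq (πV.hasFDerivAt (x := (0 : E))) (map_zero _)).prodMk
      ((𝔥.subtypeL.comp πh).hasFDerivAt (x := (0 : E)))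
    have h := hm.contDiffAt.differentiableAt_infty.hasFDerivAt.fun_comp_of_eq h1 hin0
    refine h.congr_fderiv (ContinuousLinearMap.ext fun x => ?_)
    exact (hm.fderiv_apply _ _).trans (hπ.sum x)
  obtain ⟨B, hB, hB0, -, hleft, hright⟩ := hA.exists_local_inverse hA0 hAD
  have hAadd (x : V) (y : 𝔥) : A ((x : E) + y) = G.bch (s x, y) := by
    simp only [A, hπ.left_add, hπ.right_add]
    rfl
  let N : V × V → E := fun p => G.bch (s p.1, s p.2)
  have hpair : ContDiffAt ℝ ∞ (fun p : V × V => (s p.1, s p.2)) 0 :=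
    (hs.fun_comp_of_eq contDiffAt_fst rfl).prodMk (hs.fun_comp_of_eq contDiffAt_snd rfl)
  have hpair0 : (s (0 : V × V).1, s (0 : V × V).2) = 0 := by simp [hs0]
  have hpairt := tendsto_zero_of_contDiffAt hpair hpair0
  have hN : ContDiffAt ℝ ∞ N 0 := hm.contDiffAt.fun_comp_of_eq hpair hpair0
  have hN0 : N 0 = 0 := by simp only [N]; rw [hpair0]; exact hm.map_zero
  have hNt := tendsto_zero_of_contDiffAt hN hN0
  have hBN : ContDiffAt ℝ ∞ (fun p => B (N p)) 0 := hB.fun_comp_of_eq hN hN0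
  let μ : V × V → V := fun p => πV (B (N p))
  let k : V × V → 𝔥 := fun p => πh (B (N p))
  have hμ : ContDiffAt ℝ ∞ μ 0 := πV.contDiff.contDiffAt.fun_comp_of_eq hBN rfl
  have hk : ContDiffAt ℝ ∞ k 0 := πh.contDiff.contDiffAt.fun_comp_of_eq hBN rfl
  have hμ0 : μ 0 = 0 := by simp [μ, hN0, hB0]
  have hk0 : k 0 = 0 := by simp [k, hN0, hB0]
  have hμt := tendsto_zero_of_contDiffAt hμ hμ0
  have hkt := tendsto_zero_of_contDiffAt hk hk0
  have hktE : Tendsto (fun p => (k p : E)) (𝓝 0) (𝓝 0) :=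
    (𝔥.subtypeL.continuous.tendsto 0).comp hkt
  have heqn : ∀ᶠ p in 𝓝 (0 : V × V), N p = G.bch (s (μ p), k p) := by
    filter_upwards [hNt.eventually hright] with p hp
    rw [← hAadd, hπ.sum, hp]
  have hVt : Tendsto (fun ξ : V => (ξ : E)) (𝓝 0) (𝓝 0) := V.subtypeL.continuous.tendsto 0
  have hAx : ∀ᶠ x in 𝓝 (0 : V), B (s x) = x := by
    filter_upwards [hVt.eventually hleft, hst.eventually hm.right_unit] with x h1 h2
    have h3 := hAadd x 0
    simp only [ZeroMemClass.coe_zero, add_zero] at h3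
    rw [h2] at h3
    rw [← h3, h1]
  refine ⟨μ, k, ⟨hμ0, hμ.continuousAt, ?_⟩, ⟨hμ, ?_, ?_⟩, hk, hk0, heqn, fun ν hν => ?_⟩
  · have ht : Tendsto (fun p => (s (μ p), (k p : E))) (𝓝 0) (𝓝 0) :=
      (hst.comp hμt).prodMk_nhds hktE
    filter_upwards [heqn, hpairt.eventually G.exp_bch, ht.eventually G.exp_bch,
      hμt.eventually hφQ.mem, hktE.eventually hexpH] with p h1 h2 h3 h4 h5
    refine ⟨h4, G.exp (k p), h5.2 (SetLike.coe_mem _), ?_⟩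
    rw [hpoint, hpoint, hpoint, ← h3, ← h1, ← h2]
  · filter_upwards [hAx, hst.eventually hm.right_unit] with x h1 h2
    simp only [μ, N, hs0, h2, h1, hπ.left_left]
  · filter_upwards [hAx, hst.eventually hm.left_unit] with x h1 h2
    simp only [μ, N, hs0, h2, h1, hπ.left_left]
  · have hνt : Tendsto ν (𝓝 0) (𝓝 0) := by simpa [hν.map_zero] using hν.continuousAt.tendsto
    have hqt : Tendsto (fun p => G.point φ (ν p)) (𝓝 0) (𝓝 0) :=
      G.tendsto_exp.comp (hst.comp hνt)
    have hgt : Tendsto (fun p : V × V => G.mul (G.point φ p.1) (G.point φ p.2)) (𝓝 0) (𝓝 0) :=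
      G.tendsto_mulPair.comp (G.tendsto_exp_prod.comp hpairt)
    -- The H-factor in `IsProjection` is not assumed small; left cancellation identifies it with
    -- this h, which tends to the unit, so its logarithm lies in 𝔥.
    let h : V × V → E := fun p =>
      G.mul (G.inv (G.point φ (ν p))) (G.mul (G.point φ p.1) (G.point φ p.2))
    have hht : Tendsto h (𝓝 0) (𝓝 0) :=
      G.tendsto_mulPair.comp ((G.tendsto_inv.comp hqt).prodMk_nhds hgt)
    have hlt : Tendsto (fun p => G.log (h p)) (𝓝 0) (𝓝 0) := G.tendsto_log.comp hht
    have hsum : Tendsto (fun p => (ν p : E) + G.log (h p)) (𝓝 0) (𝓝 0) := by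
      simpa using (hVt.comp hνt).add hlt
    filter_upwards [hν.isProjection, hqt.eventually_mem (G.isOpen_U₀.mem_nhds G.zero_mem_U₀),
      hgt.eventually_mem G.U_mem_nhds, hht.eventually G.exp_log, hlt.eventually hexpH,
      hsum.eventually hleft] with p ⟨_, h', hh', hgh⟩ h2 h3 h4 h5 h6
    have hhh : h' = h p := G.eq_inv_mul h2 (hH.subset_U hh') h3 hgh
    rw [hhh] at hgh hh'
    rw [h4] at h5
    have hmem := h5.1 hh'
    have h7 := hAadd (ν p) ⟨_, hmem⟩
    simp only at h7
    have h8 : G.bch (s (ν p), G.log (h p)) = N p := by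
      simp only [N]
      rw [G.bch_apply, G.bch_apply, h4, ← hpoint, ← hpoint, ← hpoint, ← hgh]
    rw [h7, h8] at h6
    show ν p = πV (B (N p))
    rw [h6]
    exact (hπ.left_add (ν p) ⟨_, hmem⟩).symm

end LocalLieGroup

/-! ### Second and third derivatives of the loop law -/

section LoopJets

variable {E : Type*} [NormedAddCommGroup E] [NormedSpace ℝ E]
  {V 𝔥 : Submodule ℝ E} {πV : E →L[ℝ] V} {πh : E →L[ℝ] 𝔥}
  {m : E × E → E} {φ : V → 𝔥} {μ : V × V → V} {k : V × V → 𝔥}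

open LocalLieGroup

/-- Comparison of the second and third order terms in the equation that defines the loop law. -/
theorem loopLaw_cubic (hπ : IsSplitting πV πh) (hm : IsUnitalGerm m)
    (hφ : ContDiffAt ℝ ∞ φ 0) (hφ0 : φ 0 = 0) (hφD : fderiv ℝ φ 0 = 0) (hμ : IsUnitalGerm μ)
    (hk : ContDiffAt ℝ ∞ k 0) (hk0 : k 0 = 0)
    (heq : ∀ᶠ p in 𝓝 (0 : V × V), m ((p.1 : E) + φ p.1, (p.2 : E) + φ p.2) =
      m ((μ p : E) + φ (μ p), k p)) (x y : V) :
    mixedXY μ x y = πV (mixedXY m x y) ∧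
    mixedXXY μ x x y + mixedXYY μ x y y =
      πV ((2 : ℝ) • mixedXY m x (quadraticPart φ y y : 𝔥) + (2 : ℝ) • mixedXY m (quadraticPart φ x x : 𝔥) y
        + mixedXXY m x x y + mixedXYY m x y y
        - (2 : ℝ) • mixedXY m ((x : E) + y)
          ((πh (mixedXY m x y) : E) - (2 : ℝ) • ((quadraticPart φ x y : 𝔥) : E))) := by
  have hR := hφ.fderiv_fderiv_symm
  have hx := HasCubicJet.line x
  have hy := HasCubicJet.line y
  have hφx := hx.comp_contDiffAt hφ hφ0
  have hφy := hy.comp_contDiffAt hφ hφ0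
  have hμj := hμ.hasCubicJet hx hy
  have hφμ := hμj.comp_contDiffAt hφ hφ0
  obtain ⟨k1, k2, k3, hkj⟩ := hk.exists_hasCubicJet hk0 (hx.prodMk hy)
  have hL := hm.hasCubicJet ((hx.clm V.subtypeL).add (hφx.clm 𝔥.subtypeL))
    ((hy.clm V.subtypeL).add (hφy.clm 𝔥.subtypeL))
  have hRr := hm.hasCubicJet ((hμj.clm V.subtypeL).add (hφμ.clm 𝔥.subtypeL)) (hkj.clm 𝔥.subtypeL)
  have hev : ∀ᶠ t in 𝓝 (0 : ℝ), _ = _ :=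
    (HasCubicJet.line ((x, y) : V × V)).tendsto_zero.eventually heq
  obtain ⟨h1, h2, h3⟩ := (hL.congr' hev).coeff_unique hRr
  simp only [hφD, zero_apply, map_zero, zero_add, add_zero, Submodule.subtypeL_apply,
    map_add, add_apply, map_smul, smul_apply, smul_zero, hR y x] at h1 h2 h3
  have hk1 : k1 = 0 := by
    have : (k1 : E) = 0 := by linear_combination (norm := module) -h1
    exact Subtype.ext this
  subst hk1
  simp only [ZeroMemClass.coe_zero, map_zero, smul_zero, add_zero] at h2 h3
  have hA : mixedXY μ x y = πV (mixedXY m x y) := by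
    have := congrArg πV h2
    simp only [map_add, map_smul, hπ.apply_right, hπ.left_left] at this
    linear_combination (norm := module) -this
  -- The term 2R(x, y) is the difference R(x+y, x+y) - R(x, x) - R(y, y).
  have hk2 : k2 = πh (mixedXY m x y) - (2 : ℝ) • quadraticPart φ x y := by
    have := congrArg πh h2
    simp only [map_add, map_smul, hπ.apply_left, hπ.right_right] at this
    simp only [quadraticPart]
    linear_combination (norm := module) -this
  refine ⟨hA, ?_⟩
  -- Projecting to V removes the third derivative of φ and the coefficient k3, both in 𝔥.
  have h4 := congrArg πV h3
  have hk2E : (k2 : E) = (πh (mixedXY m x y) : E) - (2 : ℝ) • ((quadraticPart φ x y : 𝔥) : E) := by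
    rw [hk2]; rfl
  simp only [map_add, map_smul, hπ.apply_right, hπ.left_left] at h4
  rw [← hk2E]
  simp only [quadraticPart, map_add, map_sub, map_smul, smul_apply, add_apply,
    Submodule.coe_smul]
  linear_combination (norm := module) (-2 : ℝ) • h4

end LoopJets

section LoopTensors

variable {E : Type*} [NormedAddCommGroup E] [NormedSpace ℝ E]
  {V 𝔥 : Submodule ℝ E} {πV : E →L[ℝ] V} {πh : E →L[ℝ] 𝔥}
  {m : E × E → E} {φ : V → 𝔥} {μ : V × V → V} {k : V × V → 𝔥}

open LocalLieGroup

/-- C(x, x, y) is odd in y and D(x, y, y) is even, so comparing y with -y separates them. -/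
theorem loopLaw_mixed_diag (hπ : IsSplitting πV πh) (hm : IsUnitalGerm m)
    (hφ : ContDiffAt ℝ ∞ φ 0) (hφ0 : φ 0 = 0) (hφD : fderiv ℝ φ 0 = 0) (hμ : IsUnitalGerm μ)
    (hk : ContDiffAt ℝ ∞ k 0) (hk0 : k 0 = 0)
    (heq : ∀ᶠ p in 𝓝 (0 : V × V), m ((p.1 : E) + φ p.1, (p.2 : E) + φ p.2) =
      m ((μ p : E) + φ (μ p), k p)) (x y : V) :
    mixedXXY μ x x y = πV ((2 : ℝ) • mixedXY m (quadraticPart φ x x : 𝔥) y + mixedXXY m x x y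
      - (2 : ℝ) • mixedXY m x ((πh (mixedXY m x y) : E)
        - (2 : ℝ) • ((quadraticPart φ x y : 𝔥) : E))) ∧
    mixedXYY μ x y y = πV ((2 : ℝ) • mixedXY m x (quadraticPart φ y y : 𝔥) + mixedXYY m x y y
      - (2 : ℝ) • mixedXY m y ((πh (mixedXY m x y) : E)
        - (2 : ℝ) • ((quadraticPart φ x y : 𝔥) : E))) := by
  have h1 := (loopLaw_cubic hπ hm hφ hφ0 hφD hμ hk hk0 heq x y).2
  have h2 := (loopLaw_cubic hπ hm hφ hφ0 hφD hμ hk hk0 heq x (-y)).2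
  simp only [quadraticPart, Submodule.coe_neg, Submodule.coe_smul, map_neg, map_add, map_sub,
    map_smul, neg_apply, add_apply, smul_neg, neg_neg] at h1 h2 ⊢
  constructor
  · linear_combination (norm := module) (1 / 2 : ℝ) • h1 - (1 / 2 : ℝ) • h2
  · linear_combination (norm := module) (1 / 2 : ℝ) • h1 + (1 / 2 : ℝ) • h2

/-- The third order mixed derivatives of the loop law. -/
theorem loopLaw_mixed (hπ : IsSplitting πV πh) (hm : IsUnitalGerm m)
    (hφ : ContDiffAt ℝ ∞ φ 0) (hφ0 : φ 0 = 0) (hφD : fderiv ℝ φ 0 = 0) (hμ : IsUnitalGerm μ)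
    (hk : ContDiffAt ℝ ∞ k 0) (hk0 : k 0 = 0)
    (heq : ∀ᶠ p in 𝓝 (0 : V × V), m ((p.1 : E) + φ p.1, (p.2 : E) + φ p.2) =
      m ((μ p : E) + φ (μ p), k p)) (x y z : V) :
    mixedXXY μ x y z = πV ((2 : ℝ) • mixedXY m (quadraticPart φ x y : 𝔥) z + mixedXXY m x y z
      - mixedXY m x ((πh (mixedXY m y z) : E) - (2 : ℝ) • ((quadraticPart φ y z : 𝔥) : E))
      - mixedXY m y ((πh (mixedXY m x z) : E) - (2 : ℝ) • ((quadraticPart φ x z : 𝔥) : E))) ∧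
    mixedXYY μ x y z = πV ((2 : ℝ) • mixedXY m x (quadraticPart φ y z : 𝔥) + mixedXYY m x y z
      - mixedXY m y ((πh (mixedXY m x z) : E) - (2 : ℝ) • ((quadraticPart φ x z : 𝔥) : E))
      - mixedXY m z ((πh (mixedXY m x y) : E) - (2 : ℝ) • ((quadraticPart φ x y : 𝔥) : E))) := by
  have hR := hφ.fderiv_fderiv_symm
  have h := loopLaw_mixed_diag hπ hm hφ hφ0 hφD hμ hk hk0 heq
  constructor
  · have h1 := (h (x + y) z).1
    have h2 := (h x z).1
    have h3 := (h y z).1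
    simp only [quadraticPart, Submodule.coe_add, Submodule.coe_smul, map_add, map_sub, map_smul,
      add_apply, smul_apply, hμ.mixedXXY_symm y x, hm.mixedXXY_symm (y : E) x, hR y x] at h1 h2 h3 ⊢
    linear_combination (norm := module) (1 / 2 : ℝ) • h1 - (1 / 2 : ℝ) • h2 - (1 / 2 : ℝ) • h3
  · have h1 := (h x (y + z)).2
    have h2 := (h x y).2
    have h3 := (h x z).2
    simp only [quadraticPart, Submodule.coe_add, Submodule.coe_smul, map_add, map_sub, map_smul,
      add_apply, hμ.mixedXYY_symm _ z y, hm.mixedXYY_symm _ (z : E) y, hR z y] at h1 h2 h3 ⊢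
    linear_combination (norm := module) (1 / 2 : ℝ) • h1 - (1 / 2 : ℝ) • h2 - (1 / 2 : ℝ) • h3

/-- The curvature of the loop in terms of the bracket and the quadratic part of the section. -/
theorem loopLaw_curvature (hπ : IsSplitting πV πh) (hm : IsNormalGroupGerm m)
    (hφ : ContDiffAt ℝ ∞ φ 0) (hφ0 : φ 0 = 0) (hφD : fderiv ℝ φ 0 = 0) (hμ : IsUnitalGerm μ)
    (hk : ContDiffAt ℝ ∞ k 0) (hk0 : k 0 = 0)
    (heq : ∀ᶠ p in 𝓝 (0 : V × V), m ((p.1 : E) + φ p.1, (p.2 : E) + φ p.2) =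
      m ((μ p : E) + φ (μ p), k p)) (x y z : V) :
    mixedXYY μ y x z - mixedXXY μ y x z - mixedXY μ (mixedXY μ y x) z
      + mixedXY μ y (mixedXY μ x z) =
    (-2 : ℝ) • πV (mixedXY m (mixedXY m x y) z)
      + (2 : ℝ) • πV (mixedXY m (πV (mixedXY m x y)) z)
      - (4 : ℝ) • πV (mixedXY m (quadraticPart φ x y : 𝔥) z) := by
  have hA (x y : V) : mixedXY μ x y = πV (mixedXY m x y) :=
    (loopLaw_cubic hπ hm.toIsUnitalGerm hφ hφ0 hφD hμ hk hk0 heq x y).1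
  have hmix := loopLaw_mixed hπ hm.toIsUnitalGerm hφ hφ0 hφD hμ hk hk0 heq y x z
  have hsplit (e : E) : (πh e : E) = e - (πV e : E) := by
    rw [eq_sub_iff_add_eq, add_comm]; exact hπ.sum e
  have hR : (quadraticPart φ y x : 𝔥) = quadraticPart φ x y := by
    simp only [quadraticPart, hφ.fderiv_fderiv_symm y x]
  -- After the double brackets with factor 1/3 are substituted, the two sides differ only by the
  -- Jacobi identity and by antisymmetry of the outer A.
  have hJ := congrArg πV (hm.jacobi (x : E) y z)
  have e2 := congrArg πV (hm.mixedXY_antisymm (z : E) (πV (mixedXY m y x)))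
  have e3 := congrArg πV (hm.mixedXY_antisymm (z : E) (quadraticPart φ x y : 𝔥))
  have e4 := congrArg πV (hm.mixedXY_antisymm (z : E) (mixedXY m x y))
  rw [hmix.1, hmix.2, hm.mixedXXY_eq, hm.mixedXYY_eq, hA, hA y x, hA x z, hA, hsplit, hsplit,
    hsplit, hR, hm.mixedXY_antisymm (z : E) y]
  rw [hm.mixedXY_antisymm (y : E) x] at e2 ⊢
  simp only [map_add, map_sub, map_smul, map_neg, Submodule.coe_neg, neg_apply, neg_neg]
    at hJ e2 e3 e4 ⊢
  linear_combination (norm := module) (2 / 3 : ℝ) • hJ + e2 + (2 : ℝ) • e3 + (2 : ℝ) • e4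

end LoopTensors

/-! ### The Chern connection, torsion and curvature at the unit -/

namespace ThreeWeb

variable {V : Type*} [NormedAddCommGroup V] [NormedSpace ℝ V]

theorem d_eq {α : V × V → (V × V →L[ℝ] V)} {α' : V × V →L[ℝ] (V × V →L[ℝ] V)} {p : V × V}
    (hα : HasFDerivAt α α' p) (u w : V × V) : d α p u w = α' u w - α' w u := by
  have h : HasFDerivAt
      (fun q => ContinuousAlternatingMap.ofSubsingleton ℝ (V × V) V (0 : Fin 1) (α q)) _ p :=
    (ContinuousAlternatingMap.ofSubsingletonLIE (𝕜 := ℝ) (E := V × V) (F := V)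
      (0 : Fin 1)).toContinuousLinearEquiv.hasFDerivAt.comp p hα
  rw [d, extDeriv, h.fderiv, ContinuousAlternatingMap.alternatizeUncurryFin_apply]
  simp [Fin.sum_univ_two, sub_eq_add_neg]
  rfl

variable {μ : V × V → V}

theorem P_eventuallyEq (hμ : ContDiffAt ℝ ∞ μ 0) :
    P μ =ᶠ[𝓝 0] fun p => (fderiv ℝ μ p).comp (.inl ℝ V V) := by
  filter_upwards [hμ.eventually_differentiableAt] with p hp
  exact (hp.hasFDerivAt.comp p.1 (hasFDerivAt_prodMk_left p.1 p.2)).fderiv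

theorem Q_eq {p : V × V} (hp : DifferentiableAt ℝ μ p) :
    Q μ p = (fderiv ℝ μ p).comp (.inr ℝ V V) :=
  (hp.hasFDerivAt.comp p.2 (hasFDerivAt_prodMk_right p.1 p.2)).fderiv

theorem Q_eventuallyEq (hμ : ContDiffAt ℝ ∞ μ 0) :
    Q μ =ᶠ[𝓝 0] fun p => (fderiv ℝ μ p).comp (.inr ℝ V V) := by
  filter_upwards [hμ.eventually_differentiableAt] with p hp using Q_eq hp

theorem mixed_eventuallyEq (hμ : ContDiffAt ℝ ∞ μ 0) :
    mixed μ =ᶠ[𝓝 0] fun p =>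
      (fderiv ℝ (fderiv ℝ μ) p).bilinearComp (.inl ℝ V V) (.inr ℝ V V) := by
  filter_upwards [hμ.eventually_differentiableAt.eventually_nhds,
    hμ.fderiv_infty.eventually_differentiableAt] with p hp hp2
  have hin : Tendsto (fun x : V => (x, p.2)) (𝓝 p.1) (𝓝 p) :=
    (by fun_prop : Continuous (fun x : V => (x, p.2))).tendsto p.1
  have h1 : (fun x => Q μ (x, p.2)) =ᶠ[𝓝 p.1]
      fun x => (fderiv ℝ μ (x, p.2)).comp (.inr ℝ V V) := by
    filter_upwards [hin.eventually hp] with x hx using Q_eq hx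
  have h2 : HasFDerivAt (fun x => fderiv ℝ μ (x, p.2)) _ p.1 :=
    HasFDerivAt.comp p.1 (g := fderiv ℝ μ) (f := fun x => (x, p.2)) hp2.hasFDerivAt
      (hasFDerivAt_prodMk_left p.1 p.2)
  have h3 := h2.clm_comp (hasFDerivAt_const (ContinuousLinearMap.inr ℝ V V) p.1)
  rw [mixed, h1.fderiv_eq, h3.fderiv]
  ext u v
  simp

theorem P_zero (hμ : IsUnitalGerm μ) : P μ 0 = .id ℝ V := by
  rw [(P_eventuallyEq hμ.contDiffAt).self_of_nhds]
  exact ContinuousLinearMap.ext fun x => (hμ.derivs_left x).1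

theorem Q_zero (hμ : IsUnitalGerm μ) : Q μ 0 = .id ℝ V := by
  rw [(Q_eventuallyEq hμ.contDiffAt).self_of_nhds]
  exact ContinuousLinearMap.ext fun x => (hμ.derivs_right x).1

theorem mixed_zero (hμ : IsUnitalGerm μ) : mixed μ 0 = mixedXY μ :=
  (mixed_eventuallyEq hμ.contDiffAt).self_of_nhds

theorem hasFDerivAt_P (hμ : IsUnitalGerm μ) : ∃ P' : V × V →L[ℝ] V →L[ℝ] V,
    HasFDerivAt (P μ) P' 0 ∧ ∀ u x, P' u x = mixedXY μ x u.2 := by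
  have h1 := hμ.contDiffAt.fderiv_infty.differentiableAt_infty.hasFDerivAt.clm_comp
    (hasFDerivAt_const (ContinuousLinearMap.inl ℝ V V) (0 : V × V))
  refine ⟨_, h1.congr_of_eventuallyEq (P_eventuallyEq hμ.contDiffAt), fun u x => ?_⟩
  have := hμ.fderiv_fderiv_apply u.1 u.2 x 0
  simpa using this

theorem hasFDerivAt_Q (hμ : IsUnitalGerm μ) : ∃ Q' : V × V →L[ℝ] V →L[ℝ] V,
    HasFDerivAt (Q μ) Q' 0 ∧ ∀ u x, Q' u x = mixedXY μ u.1 x := by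
  have h1 := hμ.contDiffAt.fderiv_infty.differentiableAt_infty.hasFDerivAt.clm_comp
    (hasFDerivAt_const (ContinuousLinearMap.inr ℝ V V) (0 : V × V))
  refine ⟨_, h1.congr_of_eventuallyEq (Q_eventuallyEq hμ.contDiffAt), fun u x => ?_⟩
  have := hμ.fderiv_fderiv_apply u.1 u.2 0 x
  simpa using this

theorem differentiableAt_flip {X Y Z W : Type*} [NormedAddCommGroup X] [NormedSpace ℝ X]
    [NormedAddCommGroup Y] [NormedSpace ℝ Y] [NormedAddCommGroup Z] [NormedSpace ℝ Z]
    [NormedAddCommGroup W] [NormedSpace ℝ W] {f : W → X →L[ℝ] Y →L[ℝ] Z} {p : W}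
    (hf : DifferentiableAt ℝ f p) : DifferentiableAt ℝ (fun q => (f q).flip) p := by
  let L : (X →L[ℝ] Y →L[ℝ] Z) →L[ℝ] (Y →L[ℝ] X →L[ℝ] Z) :=
    (ContinuousLinearMap.flipₗᵢ ℝ X Y Z).toContinuousLinearEquiv.toContinuousLinearMap
  exact DifferentiableAt.comp (𝕜 := ℝ) (F := X →L[ℝ] Y →L[ℝ] Z) (G := Y →L[ℝ] X →L[ℝ] Z) (g := L)
    p L.differentiableAt hf

theorem differentiableAt_bilinearComp {X Y Z W : Type*} [NormedAddCommGroup X] [NormedSpace ℝ X]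
    [NormedAddCommGroup Y] [NormedSpace ℝ Y] [NormedAddCommGroup Z] [NormedSpace ℝ Z]
    [NormedAddCommGroup W] [NormedSpace ℝ W] {f : W → X →L[ℝ] X →L[ℝ] Z} {g h : W → Y →L[ℝ] X}
    {p : W} (hf : DifferentiableAt ℝ f p) (hg : DifferentiableAt ℝ g p)
    (hh : DifferentiableAt ℝ h p) :
    DifferentiableAt ℝ (fun q => (f q).bilinearComp (g q) (h q)) p :=
  differentiableAt_flip ((differentiableAt_flip (hf.clm_comp hg)).clm_comp hh)

theorem hasFDerivAt_mixed (hμ : IsUnitalGerm μ) : ∃ M' : V × V →L[ℝ] V →L[ℝ] V →L[ℝ] V,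
    HasFDerivAt (mixed μ) M' 0 ∧
      ∀ u x y, M' u x y = mixedXXY μ u.1 x y + mixedXYY μ x u.2 y := by
  have hD := hμ.contDiffAt.fderiv_infty.fderiv_infty.differentiableAt_infty
  have hd : DifferentiableAt ℝ (mixed μ) 0 :=
    (differentiableAt_bilinearComp hD (differentiableAt_const _)
      (differentiableAt_const _)).congr_of_eventuallyEq (mixed_eventuallyEq hμ.contDiffAt)
  refine ⟨_, hd.hasFDerivAt, fun u x y => ?_⟩
  have h1 := (hd.hasFDerivAt.clm_apply (hasFDerivAt_const x (0 : V × V))).clm_apply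
    (hasFDerivAt_const y (0 : V × V))
  have h2 := (hD.hasFDerivAt.clm_apply (hasFDerivAt_const ((x, 0) : V × V) (0 : V × V))).clm_apply
    (hasFDerivAt_const ((0, y) : V × V) (0 : V × V))
  have h3 := h1.unique (h2.congr_of_eventuallyEq (by
    filter_upwards [mixed_eventuallyEq hμ.contDiffAt] with p hp
    rw [hp]; rfl))
  have h4 := congrArg (fun L : V × V →L[ℝ] V => L u) h3
  simp only [ContinuousLinearMap.comp_zero, ContinuousLinearMap.flip_apply, zero_add] at h4
  rw [h4]
  have hu : u = (u.1, 0) + (0, u.2) := by simp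
  conv_lhs => rw [hu]
  simp only [map_add, add_apply]
  rw [hμ.contDiffAt.fderiv_fderiv_fderiv_symm_left (0, u.2)]
  rfl

theorem hasFDerivAt_inverse_id [CompleteSpace V] : HasFDerivAt
    (ContinuousLinearMap.inverse : (V →L[ℝ] V) → V →L[ℝ] V) (-.id ℝ (V →L[ℝ] V)) (.id ℝ V) := by
  have h := hasFDerivAt_ringInverse (𝕜 := ℝ) (1 : (V →L[ℝ] V)ˣ)
  rw [ContinuousLinearMap.ringInverse_eq_inverse] at h
  refine h.congr_fderiv ?_
  ext A x
  simp

/-- The two quadratic terms come from P⁻¹ and Q⁻¹: inversion has derivative -id at the identity. -/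
theorem hasFDerivAt_Γ [CompleteSpace V] (hμ : IsUnitalGerm μ) :
    ∃ Γ' : V × V →L[ℝ] V →L[ℝ] V →L[ℝ] V, HasFDerivAt (Γ μ) Γ' 0 ∧
      ∀ u x y, Γ' u x y = -(mixedXXY μ u.1 x y + mixedXYY μ x u.2 y
        - mixedXY μ (mixedXY μ x u.2) y - mixedXY μ x (mixedXY μ u.1 y)) := by
  obtain ⟨P', hP, hP'⟩ := hasFDerivAt_P hμ
  obtain ⟨Q', hQ, hQ'⟩ := hasFDerivAt_Q hμ
  obtain ⟨M', hM, hM'⟩ := hasFDerivAt_mixed hμ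
  have hPi := (hasFDerivAt_inverse_id (V := V)).fun_comp_of_eq hP (P_zero hμ)
  have hQi := (hasFDerivAt_inverse_id (V := V)).fun_comp_of_eq hQ (Q_zero hμ)
  have hd : DifferentiableAt ℝ (Γ μ) 0 := by
    have h := differentiableAt_bilinearComp hM.differentiableAt hPi.differentiableAt
      hQi.differentiableAt
    exact DifferentiableAt.neg (𝕜 := ℝ) (F := V →L[ℝ] V →L[ℝ] V) h
  refine ⟨_, hd.hasFDerivAt, fun u x y => ?_⟩
  have h1 := (hd.hasFDerivAt.clm_apply (hasFDerivAt_const x (0 : V × V))).clm_apply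
    (hasFDerivAt_const y (0 : V × V))
  have h2 := ((hM.clm_apply (hPi.clm_apply (hasFDerivAt_const x (0 : V × V)))).clm_apply
    (hQi.clm_apply (hasFDerivAt_const y (0 : V × V)))).neg
  have h3 := congrArg (fun L : V × V →L[ℝ] V => L u) (h1.unique h2)
  have hPi0 : (P μ 0).inverse = .id ℝ V := by rw [P_zero hμ]; simp
  have hQi0 : (Q μ 0).inverse = .id ℝ V := by rw [Q_zero hμ]; simp
  simp only [hPi0, hQi0, mixed_zero hμ, add_apply, neg_apply, ContinuousLinearMap.comp_apply,
    ContinuousLinearMap.flip_apply, zero_apply, map_zero, zero_add, ContinuousLinearMap.id_apply,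
    hP', hQ', hM', map_neg] at h3
  rw [h3]
  abel

end ThreeWeb

namespace ThreeWeb

variable {V : Type*} [NormedAddCommGroup V] [NormedSpace ℝ V] {μ : V × V → V}

theorem Γ_zero (hμ : IsUnitalGerm μ) (x y : V) : Γ μ 0 x y = -mixedXY μ x y := by
  simp [Γ, P_zero hμ, Q_zero hμ, mixed_zero hμ]

theorem ω₁_zero (hμ : IsUnitalGerm μ) (u : V × V) : ω₁ μ 0 u = u.1 := by
  simp [ω₁, P_zero hμ]

theorem ω₂_zero (hμ : IsUnitalGerm μ) (u : V × V) : ω₂ μ 0 u = u.2 := by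
  simp [ω₂, Q_zero hμ]

theorem connectionForm_zero (hμ : IsUnitalGerm μ) (v : V) (u : V × V) :
    connectionForm μ v 0 u = -mixedXY μ u.1 v - mixedXY μ v u.2 := by
  simp [connectionForm, Γ_zero hμ, ω₁_zero hμ, ω₂_zero hμ, sub_eq_add_neg]

theorem hasFDerivAt_ω₁ (hμ : IsUnitalGerm μ) : ∃ L : V × V →L[ℝ] V × V →L[ℝ] V,
    HasFDerivAt (ω₁ μ) L 0 ∧ ∀ u w, L u w = mixedXY μ w.1 u.2 := by
  obtain ⟨P', hP, hP'⟩ := hasFDerivAt_P hμ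
  have h : HasFDerivAt (ω₁ μ) _ 0 :=
    hP.clm_comp (hasFDerivAt_const (ContinuousLinearMap.fst ℝ V V) (0 : V × V))
  exact ⟨_, h, fun u w => by simp [hP']⟩

theorem hasFDerivAt_ω₂ (hμ : IsUnitalGerm μ) : ∃ L : V × V →L[ℝ] V × V →L[ℝ] V,
    HasFDerivAt (ω₂ μ) L 0 ∧ ∀ u w, L u w = mixedXY μ u.1 w.2 := by
  obtain ⟨Q', hQ, hQ'⟩ := hasFDerivAt_Q hμ
  have h : HasFDerivAt (ω₂ μ) _ 0 :=
    hQ.clm_comp (hasFDerivAt_const (ContinuousLinearMap.snd ℝ V V) (0 : V × V))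
  exact ⟨_, h, fun u w => by simp [hQ']⟩

theorem hasFDerivAt_connectionForm [CompleteSpace V] (hμ : IsUnitalGerm μ) (v : V) :
    ∃ L : V × V →L[ℝ] V × V →L[ℝ] V, HasFDerivAt (connectionForm μ v) L 0 ∧
      ∀ u w, L u w = -mixedXXY μ u.1 w.1 v - mixedXYY μ w.1 u.2 v
        + mixedXY μ w.1 (mixedXY μ u.1 v) - mixedXXY μ u.1 v w.2 - mixedXYY μ v u.2 w.2
        + mixedXY μ (mixedXY μ v u.2) w.2 := by
  obtain ⟨Γ', hΓ, hΓ'⟩ := hasFDerivAt_Γ hμ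
  obtain ⟨L₁, h₁, h₁'⟩ := hasFDerivAt_ω₁ hμ
  obtain ⟨L₂, h₂, h₂'⟩ := hasFDerivAt_ω₂ hμ
  have hflip := (differentiableAt_flip hΓ.differentiableAt).clm_apply
    (differentiableAt_const (c := v))
  have hd : DifferentiableAt ℝ (connectionForm μ v) 0 :=
    (hflip.clm_comp h₁.differentiableAt).add
      ((hΓ.differentiableAt.clm_apply (differentiableAt_const (c := v))).clm_comp
        h₂.differentiableAt)
  refine ⟨_, hd.hasFDerivAt, fun u w => ?_⟩
  have h3 := hd.hasFDerivAt.clm_apply (hasFDerivAt_const w (0 : V × V))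
  have h4 := ((hΓ.clm_apply (h₁.clm_apply (hasFDerivAt_const w (0 : V × V)))).clm_apply
      (hasFDerivAt_const v (0 : V × V))).fun_add
    ((hΓ.clm_apply (hasFDerivAt_const v (0 : V × V))).clm_apply
      (h₂.clm_apply (hasFDerivAt_const w (0 : V × V))))
  have h5 := congrArg (fun L : V × V →L[ℝ] V => L u) (h3.unique h4)
  simp only [add_apply, ContinuousLinearMap.comp_apply, ContinuousLinearMap.flip_apply,
    zero_apply, map_zero, Prod.fst_zero, Prod.snd_zero, zero_add, hΓ', h₁', h₂', ω₁_zero hμ, ω₂_zero hμ, Γ_zero hμ] at h5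
  rw [h5]
  abel

/-- The torsion and the curvature at `(0, 0)` of the 3-web of a local loop with unit `0`. -/
theorem hasTensorsAt_iff [CompleteSpace V] (hμ : IsUnitalGerm μ) (a : V →ₗ[ℝ] V →ₗ[ℝ] V)
    (b : V →ₗ[ℝ] V →ₗ[ℝ] V →ₗ[ℝ] V) : HasTensorsAt μ 0 a b ↔
      (∀ x y, a x y = (1 / 2 : ℝ) • (mixedXY μ y x - mixedXY μ x y)) ∧
      ∀ x y z, b x y z = mixedXYY μ y x z - mixedXXY μ y x z - mixedXY μ (mixedXY μ y x) z
        + mixedXY μ y (mixedXY μ x z) := by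
  obtain ⟨L₁, h₁, h₁'⟩ := hasFDerivAt_ω₁ hμ
  obtain ⟨L₂, h₂, h₂'⟩ := hasFDerivAt_ω₂ hμ
  constructor
  · intro h
    constructor
    · intro x y
      -- Two x-directions isolate a; for b below, one x- and one y-direction leave a single
      -- curvature term.
      have h3 := h.d_ω₁ (x, 0) (y, 0)
      simp only [d_eq h₁, h₁', ω₁_zero hμ, connectionForm_zero hμ, map_zero] at h3
      rw [h.skew y x] at h3
      linear_combination (norm := module) (-1 / 2 : ℝ) • h3
    · intro x y z
      obtain ⟨L, hL, hL'⟩ := hasFDerivAt_connectionForm hμ x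
      have h3 := h.d_connectionForm x (y, 0) (0, z)
      simp only [d_eq hL, hL', ω₁_zero hμ, ω₂_zero hμ, connectionForm_zero hμ, map_zero,
        zero_apply, map_neg, neg_apply, sub_zero, zero_sub, neg_zero, add_zero, neg_neg] at h3
      rw [hμ.mixedXYY_symm y z x] at h3
      linear_combination (norm := module) -h3
  · rintro ⟨ha, hb⟩
    refine ⟨fun x y => ?_, fun u w => ?_, fun u w => ?_, fun v u w => ?_⟩
    · rw [ha, ha]; module
    · simp only [d_eq h₁, h₁', ω₁_zero hμ, connectionForm_zero hμ, ha]
      module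
    · simp only [d_eq h₂, h₂', ω₂_zero hμ, connectionForm_zero hμ, ha]
      module
    · obtain ⟨L, hL, hL'⟩ := hasFDerivAt_connectionForm hμ v
      simp only [d_eq hL, hL', ω₁_zero hμ, ω₂_zero hμ, connectionForm_zero hμ, hb, map_sub,
        map_neg, sub_apply, neg_apply]
      rw [hμ.mixedXXY_symm u.1 w.1, hμ.mixedXYY_symm w.1 u.2, hμ.mixedXYY_symm u.1 w.2,
        hμ.mixedXYY_symm v u.2]
      module

theorem exists_hasTensorsAt [CompleteSpace V] (hμ : IsUnitalGerm μ) :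
    ∃ (a : V →ₗ[ℝ] V →ₗ[ℝ] V) (b : V →ₗ[ℝ] V →ₗ[ℝ] V →ₗ[ℝ] V), HasTensorsAt μ 0 a b := by
  refine ⟨LinearMap.mk₂ ℝ (fun x y => (1 / 2 : ℝ) • (mixedXY μ y x - mixedXY μ x y)) ?_ ?_ ?_ ?_,
    LinearMap.mk₂ ℝ (fun x y => ((mixedXYY μ y x - mixedXXY μ y x - mixedXY μ (mixedXY μ y x)
      + (mixedXY μ y).comp (mixedXY μ x) : V →L[ℝ] V) : V →ₗ[ℝ] V)) ?_ ?_ ?_ ?_,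
    (hasTensorsAt_iff hμ _ _).2 ⟨fun x y => rfl, fun x y z => rfl⟩⟩
  · intro x x' y; simp only [map_add, add_apply]; module
  · intro c x y; simp only [map_smul, smul_apply]; module
  · intro x y y'; simp only [map_add, add_apply]; module
  · intro c x y; simp only [map_smul, smul_apply]; module
  · intro x x' y; ext z; simp; abel
  · intro c x y; ext z; simp [smul_sub]
  · intro x y y'; ext z; simp; abel
  · intro c x y; ext z; simp [smul_sub]

end ThreeWeb

end

/-! ### The main theorem -/

theorem proposition3p1 {E : Type*} [NormedAddCommGroup E] [NormedSpace ℝ E]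
    [FiniteDimensional ℝ E] (G : LocalLieGroup E) (H Q : Set E) (V 𝔥 : Submodule ℝ E)
    (hH : G.IsLocalLieSubgroup H 𝔥) (hQ : LocalLieGroup.IsLocalSection Q V 𝔥) :
    (∃ (φ : V → 𝔥) (μ : V × V → V), G.IsSectionMap Q φ ∧ G.IsLoopLaw H Q φ μ) ∧
    ∀ (φ : V → 𝔥) (μ : V × V → V), G.IsSectionMap Q φ → G.IsLoopLaw H Q φ μ →
      ContDiffAt ℝ ∞ φ 0 ∧ fderiv ℝ φ 0 = 0 ∧ ContDiffAt ℝ ∞ μ 0 ∧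
      (∃ (a : V →ₗ[ℝ] V →ₗ[ℝ] V) (b : V →ₗ[ℝ] V →ₗ[ℝ] V →ₗ[ℝ] V),
        ThreeWeb.HasTensorsAt μ 0 a b) ∧
      ∀ (a : V →ₗ[ℝ] V →ₗ[ℝ] V) (b : V →ₗ[ℝ] V →ₗ[ℝ] V →ₗ[ℝ] V),
        ThreeWeb.HasTensorsAt μ 0 a b →
        (∀ x y : V, a x y =
          -(1 / 2 : ℝ) • V.projectionOnto 𝔥 hQ.isCompl (G.bracket x y)) ∧
        ∀ x y z : V, b x y z =
          -(1 / 2 : ℝ) • V.projectionOnto 𝔥 hQ.isCompl (G.bracket (G.bracket x y) z)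
          + (1 / 2 : ℝ) • V.projectionOnto 𝔥 hQ.isCompl
              (G.bracket (V.projectionOnto 𝔥 hQ.isCompl (G.bracket x y)) z)
          - (2 : ℝ) • V.projectionOnto 𝔥 hQ.isCompl (G.bracket (quadraticPart φ x y : 𝔥) z) := by
  let πV : E →L[ℝ] V := (V.projectionOnto 𝔥 hQ.isCompl).toContinuousLinearMap
  let πh : E →L[ℝ] 𝔥 := (𝔥.projectionOnto V hQ.isCompl.symm).toContinuousLinearMap
  have hπV (x : E) : V.projectionOnto 𝔥 hQ.isCompl x = πV x := rfl
  have hπ : LocalLieGroup.IsSplitting πV πh :=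
    ⟨fun x => Submodule.projection_add_projection_eq_self hQ.isCompl x,
      fun k => Submodule.projectionOnto_apply_right hQ.isCompl k,
      fun x => Submodule.projectionOnto_apply_right hQ.isCompl.symm x⟩
  obtain ⟨φ₀, hφ₀Q, hφ₀, hφ₀D, hφ₀u⟩ := G.exists_isSectionMap hπ hQ.isSubmanifold
  refine ⟨?_, fun φ μ hφQ hμL => ?_⟩
  · obtain ⟨μ, -, hμ, -⟩ := G.exists_isLoopLaw hπ hH hφ₀Q hφ₀ hφ₀D
    exact ⟨φ₀, μ, hφ₀Q, hμ⟩
  -- Smoothness of an arbitrary φ, and below of μ, is inherited from the constructed germ by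
  -- uniqueness.
  have hφeq := hφ₀u φ hφQ
  have hφ : ContDiffAt ℝ ∞ φ 0 := hφ₀.congr_of_eventuallyEq hφeq
  have hφD : fderiv ℝ φ 0 = 0 := by rw [hφeq.fderiv_eq, hφ₀D]
  obtain ⟨ν, k, -, hν, hk, hk0, heq, hu⟩ := G.exists_isLoopLaw hπ hH hφQ hφ hφD
  have hμν := hu μ hμL
  have hμ : IsUnitalGerm μ := by
    have hl : Tendsto (fun x : V => ((x, 0) : V × V)) (𝓝 0) (𝓝 0) :=
      (by fun_prop : Continuous (fun x : V => ((x, 0) : V × V))).tendsto 0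
    have hr : Tendsto (fun x : V => ((0, x) : V × V)) (𝓝 0) (𝓝 0) :=
      (by fun_prop : Continuous (fun x : V => ((0, x) : V × V))).tendsto 0
    refine ⟨hν.contDiffAt.congr_of_eventuallyEq hμν, ?_, ?_⟩
    · filter_upwards [hl.eventually hμν, hν.right_unit] with x h1 h2 using h1.trans h2
    · filter_upwards [hr.eventually hμν, hν.left_unit] with x h1 h2 using h1.trans h2
  have heqμ : ∀ᶠ p in 𝓝 (0 : V × V), G.bch ((p.1 : E) + φ p.1, (p.2 : E) + φ p.2) =
      G.bch ((μ p : E) + φ (μ p), k p) := by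
    filter_upwards [heq, hμν] with p h1 h2
    rw [h1, h2]
  have hm := G.isNormalGroupGerm_bch
  have : CompleteSpace V := FiniteDimensional.complete ℝ V
  refine ⟨hφ, hφD, hμ.contDiffAt, ThreeWeb.exists_hasTensorsAt hμ, fun a b hab => ?_⟩
  obtain ⟨ha, hb⟩ := (ThreeWeb.hasTensorsAt_iff hμ a b).1 hab
  have hA (x y : V) :=
    (loopLaw_cubic hπ hm.toIsUnitalGerm hφ hφQ.map_zero hφD hμ hk hk0 heqμ x y).1
  constructor
  · intro x y
    rw [ha, hA, hA, hm.mixedXY_antisymm (y : E) x, G.bracket_eq_bch, hπV, map_neg, map_smul]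
    module
  · intro x y z
    rw [hb, loopLaw_curvature hπ hm hφ hφQ.map_zero hφD hμ hk hk0 heqμ]
    -- Since [·,·] = 2A, double brackets are 4 A∘A: the coefficients -2, 2, -4 become -1/2, 1/2, -2.
    simp only [G.bracket_eq_bch, hπV, map_smul, smul_apply, Submodule.coe_smul]
    module
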